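/- Let $\Phi$ be a finite reduced crystallographic root system in a real vector space, with simple roots $\Pi$, positive roots $\Phi^+$, Weyl group $W$, simple reflections $S$ (indexed by $\Pi$), length function $\ell$ and (strong) Bruhat order $\le$. For $w\in W$ put $$P_w(q)=\sum_{x\le w}q^{\ell(x)},\qquad R_w(q)=\sum_{r}q^{d(r_0,r)},$$ where $r$ runs over the chambers of the inversion arrangement $\mathcal A_w$ consisting of the hyperplanes $\alpha(x)=0$ with $\alpha\in\Phi^+$, $w(\alpha)\in-\Phi^+$; here $r_0$ is the chamber on which all these $\alpha$ are positive and $d(r_0,r)$ is the number of hyperplanes of $\mathcal A_w$ separating $r_0$ from $r$. For $J\subseteq S$ let $W_J$ be the subgroup generated by $J$ and ${}^JW$ the set of minimal length representatives of the cosets $W_Jx$. Let $s\in S$ be a leaf of the Dynkin diagram (a vertex with at most one neighbour), $J=S\setminus\{s\}$. We say that $uv$ is a BP-decomposition of $w$ with respect to $J$ if, for $w_1=w$ or for $w_1=w^{-1}$, one has $w_1=uv$ with $u\in W_J$, $v\in{}^JW$, and $u$ is the maximum of $\{x\in W_J: x\le w_1\}$. Let $I$ be the set of simple reflections occurring in a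 reduced word of $v$, and let ${}^{I\cap J}W_I$ be the set of minimal length representatives of the cosets $W_{I\cap J}x$ in $W_I$. Call $v$ locally-longest if $v$ is the longest element of ${}^{I\cap J}W_I$ and $I$ spans a connected subgraph of the Dynkin diagram (the empty set counting as connected), and say that $v$ is in a local chain if ${}^{I\cap J}W_I$ is totally ordered by the Bruhat order. **Proposition.** Let $w\in W$ (in particular, $w$ may be any element whose Schubert variety is rationally smooth) and let $uv$ be a BP-decomposition of $w$ with respect to $J=S\setminus\{s\}$, $s$ a leaf. If $v$ is locally-longest or is in a local chain, then $P_u(q)=R_u(q)$ implies $P_w(q)=R_w(q)$. -/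

import Mathlib

open Set Polynomial

noncomputable section

namespace HyperplaneArrangement

variable {V : Type*} [AddCommGroup V] [Module ℝ V]

/-- The chamber containing `x` of an arrangement `A` of linear hyperplanes in a real vector space:
the set of all points that lie strictly on the same side as `x` of every hyperplane of `A`. -/
def chamberOf (A : Set (Submodule ℝ V)) (x : V) : Set V :=
  {y | ∀ H ∈ A, H.toAffineSubspace.SSameSide x y}

/-- The chambers (regions) of the arrangement `A`: the chambers of the points that lie on no
hyperplane of `A`. -/
def chambers (A : Set (Submodule ℝ V)) : Set (Set V) :=
  {C | ∃ x : V, (∀ H ∈ A, x ∉ H) ∧ C = chamberOf A x}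

/-- The number of hyperplanes of `A` that separate `C` and `D`. -/
def separation (A : Set (Submodule ℝ V)) (C D : Set V) : ℕ :=
  Set.ncard {H ∈ A | ∀ x ∈ C, ∀ y ∈ D, H.toAffineSubspace.SOppSide x y}

/-- Strictly on the same side of the hyperplane `f = 0` means equal nonzero signs of `f`. -/
theorem sSameSide_ker_iff (f : Module.Dual ℝ V) (x y : V) :
    (LinearMap.ker f).toAffineSubspace.SSameSide x y ↔ 0 < f x * f y := by
  constructor
  · rintro ⟨⟨p, hp, r, hr, h⟩, hx, hy⟩
    rw [Submodule.mem_toAffineSubspace, LinearMap.mem_ker] at hp hr hx hy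
    have h' := h.map f
    simp only [vsub_eq_sub, map_sub, hp, hr, sub_zero] at h'
    rcases h' with h0 | h0 | ⟨r₁, r₂, h₁, h₂, h₃⟩
    · exact absurd h0 hx
    · exact absurd h0 hy
    · simp only [smul_eq_mul] at h₃
      have hpos : 0 < r₁ * (f x * f x) := mul_pos h₁ (mul_self_pos.2 hx)
      have : r₁ * (f x * f x) = r₂ * (f x * f y) := by linear_combination (f x) * h₃
      rw [this] at hpos
      exact (mul_pos_iff_of_pos_left h₂).1 hpos
  · intro h
    have hx : f x ≠ 0 := fun h0 => by simp [h0] at h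
    have hy : f y ≠ 0 := fun h0 => by simp [h0] at h
    refine ⟨⟨0, by simp, y - (f y / f x) • x, ?_, ?_⟩, by simpa using hx, by simpa using hy⟩
    · rw [Submodule.mem_toAffineSubspace, LinearMap.mem_ker]
      simp [hx]
    · have hr : 0 ≤ f y / f x := by
        have : f y / f x = (f x * f y) / (f x * f x) := by field_simp
        rw [this]
        exact div_nonneg h.le (mul_self_nonneg _)
      have h' : SameRay ℝ x ((f y / f x) • x) := SameRay.sameRay_nonneg_smul_right x hr
      rw [vsub_eq_sub, vsub_eq_sub, sub_zero, sub_sub_cancel]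
      exact h'

/-- An arrangement of finitely many hyperplanes has finitely many chambers. -/
theorem finite_chambers {κ : Type*} [Finite κ] (f : κ → Module.Dual ℝ V) :
    (chambers (range fun k => LinearMap.ker (f k))).Finite := by
  classical
  have key : ∀ x y : V, (∀ k, f k x ≠ 0) → (∀ k, f k y ≠ 0) →
      {k | 0 < f k x} = {k | 0 < f k y} →
      chamberOf (range fun k => LinearMap.ker (f k)) x =
        chamberOf (range fun k => LinearMap.ker (f k)) y := by
    intro x y hx hy hxy
    ext z
    simp only [chamberOf, mem_ofPred_eq, forall_mem_range, sSameSide_ker_iff]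
    refine forall_congr' fun k => ?_
    have hk : 0 < f k x ↔ 0 < f k y := by
      simpa using Set.ext_iff.1 hxy k
    rcases lt_or_gt_of_ne (hx k) with h1 | h1
    · have h2 : f k y < 0 :=
        lt_of_le_of_ne (not_lt.1 fun h => absurd (hk.2 h) (not_lt.2 h1.le)) (hy k)
      constructor <;> intro h
      · exact mul_pos_of_neg_of_neg h2 (neg_of_mul_pos_right h h1.le)
      · exact mul_pos_of_neg_of_neg h1 (neg_of_mul_pos_right h h2.le)
    · have h2 := hk.1 h1
      rw [mul_pos_iff_of_pos_left h1, mul_pos_iff_of_pos_left h2]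
  let F : Set κ → Set V := fun D =>
    if h : ∃ x : V, (∀ k, f k x ≠ 0) ∧ {k | 0 < f k x} = D then
      chamberOf (range fun k => LinearMap.ker (f k)) h.choose else ∅
  refine (Set.finite_range F).subset ?_
  rintro C ⟨x, hx, rfl⟩
  have hx' : ∀ k, f k x ≠ 0 := fun k => by simpa using hx _ ⟨k, rfl⟩
  have h : ∃ y : V, (∀ k, f k y ≠ 0) ∧ {k | 0 < f k y} = {k | 0 < f k x} := ⟨x, hx', rfl⟩
  refine ⟨{k | 0 < f k x}, ?_⟩
  simp only [F, dif_pos h]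
  exact key _ _ h.choose_spec.1 hx' h.choose_spec.2

end HyperplaneArrangement

namespace WeylBruhat

variable {ι M N : Type*} [AddCommGroup M] [Module ℝ M] [AddCommGroup N] [Module ℝ N]

/-- The Weyl group of a finite root system is finite. -/
instance finite_weylGroup [Finite ι] (P : RootPairing ι ℝ M N) [P.IsRootSystem] :
    Finite P.weylGroup := by
  refine Finite.of_injective (fun g : P.weylGroup => P.weylGroupToPerm g) fun g g' h => ?_
  apply Subtype.ext
  apply RootPairing.Equiv.weightHom_injective P
  apply LinearEquiv.toLinearMap_injective
  refine LinearMap.ext_on_range (RootPairing.IsRootSystem.span_root_eq_top (P := P)) fun i => ?_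
  have h1 := P.weylGroup_apply_root g i
  have h2 := P.weylGroup_apply_root g' i
  have h3 : P.weylGroupToPerm g i = P.weylGroupToPerm g' i := DFunLike.congr_fun h i
  rw [h3, ← h2] at h1
  exact h1

variable {P : RootPairing ι ℝ M N} (b : P.Base)

/-- The simple reflection of a simple root. The set `S` is indexed by the simple roots. -/
def simple (i : b.support) : P.weylGroup :=
  RootPairing.weylGroup.ofIdx P (i : ι)

/-- The product of a word in the simple reflections. -/
def wordProd (l : List b.support) : P.weylGroup :=
  (l.map (simple b)).prod

/-- The length `ℓ(w)`: the least length of a word in the simple reflections with product `w`. -/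
def length (w : P.weylGroup) : ℕ :=
  sInf {n | ∃ l : List b.support, l.length = n ∧ wordProd b l = w}

/-- The set `T` of reflections, the conjugates of the simple reflections. -/
def IsReflection (t : P.weylGroup) : Prop :=
  ∃ (w : P.weylGroup) (i : b.support), t = w * simple b i * w⁻¹

/-- The (strong) Bruhat order on the Weyl group: the reflexive and transitive closure of
`x < x t` for reflections `t` with `ℓ(x) < ℓ(x t)`. -/
def BruhatLE (x y : P.weylGroup) : Prop :=
  Relation.ReflTransGen
    (fun x y => ∃ t, IsReflection b t ∧ y = x * t ∧ length b x < length b y) x y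

/-- The Poincaré polynomial `P_w(q) = ∑_{x ≤ w} q ^ ℓ(x)`. -/
def poincarePoly [Finite ι] [P.IsRootSystem] (w : P.weylGroup) : ℤ[X] :=
  ∑ x ∈ (Set.toFinite {x | BruhatLE b x w}).toFinset, X ^ length b x

/-- The inversion set `Δ_w`: the (indices of) positive roots `α` such that `w(α)` is negative. -/
def inversionSet (w : P.weylGroup) : Set ι :=
  {i | b.IsPos i ∧ ¬ b.IsPos (P.weylGroupToPerm w i)}

/-- The inversion arrangement `𝒜_w`: the hyperplanes `α(x) = 0` for `α ∈ Δ_w`. -/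
def inversionArrangement (w : P.weylGroup) : Set (Submodule ℝ N) :=
  {H | ∃ i ∈ inversionSet b w, H = LinearMap.ker (P.root' i)}

/-- The fundamental chamber `r₀` of `𝒜_w`. -/
def fundamentalChamber (w : P.weylGroup) : Set N :=
  {x | ∀ i ∈ inversionSet b w, 0 < P.root' i x}

theorem finite_chambers_inversionArrangement [Finite ι] (w : P.weylGroup) :
    (HyperplaneArrangement.chambers (inversionArrangement b w)).Finite := by
  have h : inversionArrangement b w =
      range fun k : inversionSet b w => LinearMap.ker (P.root' (k : ι)) := by
    ext H
    simp [inversionArrangement, eq_comm]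
  rw [h]
  exact HyperplaneArrangement.finite_chambers fun k : inversionSet b w => P.root' (k : ι)

/-- The distance enumerating polynomial `R_w(q) = ∑_r q ^ d(r₀, r)`, over all chambers `r`
of `𝒜_w`. -/
def distancePoly [Finite ι] (w : P.weylGroup) : ℤ[X] :=
  ∑ r ∈ (finite_chambers_inversionArrangement b w).toFinset,
    X ^ HyperplaneArrangement.separation (inversionArrangement b w) (fundamentalChamber b w) r

/-- The Dynkin diagram as a simple graph on the simple roots: two distinct simple roots are joined
if they are not orthogonal. -/
def dynkinGraph : SimpleGraph b.support where
  Adj i j := i ≠ j ∧ (P.pairing i j ≠ 0 ∨ P.pairing j i ≠ 0)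
  symm := ⟨fun _ _ h => ⟨h.1.symm, h.2.symm⟩⟩
  loopless := ⟨fun _ h => h.1 rfl⟩

/-- A leaf of the Dynkin diagram: a vertex with at most one neighbour (so that the only vertex of a
component of rank one counts as a leaf). -/
def IsLeaf (s : b.support) : Prop :=
  ((dynkinGraph b).neighborSet s).Subsingleton

/-- The standard parabolic subgroup `W_J`. -/
def parabolic (J : Set b.support) : Subgroup P.weylGroup :=
  Subgroup.closure (simple b '' J)

/-- The elements of minimal length in their cosets `W_J x`; for the whole group this is `ᴶW`. -/
def minReps (J : Set b.support) : Set P.weylGroup :=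
  {x | ∀ y ∈ parabolic b J, length b x ≤ length b (y * x)}

/-- The set of simple roots whose reflections appear in a reduced word of `v`. -/
def letters (v : P.weylGroup) : Set b.support :=
  {i | ∃ l : List b.support, wordProd b l = v ∧ l.length = length b v ∧ i ∈ l}

/-- The embedded quotient `^{I ∩ J}W_I`: the minimal length representatives of the
cosets `W_{I ∩ J} x` in `W_I`. -/
def embeddedQuotient (I J : Set b.support) : Set P.weylGroup :=
  {x | x ∈ parabolic b I ∧ x ∈ minReps b (I ∩ J)}

/-- `v` is locally-longest with respect to `J`: with `I` the set of letters of `v`, the element `v`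
is the longest element of `^{I ∩ J}W_I` and `I` is a connected subgraph of the Dynkin diagram. -/
def IsLocallyLongest (J : Set b.support) (v : P.weylGroup) : Prop :=
  v ∈ embeddedQuotient b (letters b v) J ∧
    (∀ x ∈ embeddedQuotient b (letters b v) J, length b x ≤ length b v) ∧
    ((dynkinGraph b).induce (letters b v)).Preconnected

/-- `v` is in a local chain with respect to `J`: with `I` the set of letters of `v`, the quotient
`^{I ∩ J}W_I` is totally ordered by the Bruhat order. -/
def IsInLocalChain (J : Set b.support) (v : P.weylGroup) : Prop :=
  ∀ x ∈ embeddedQuotient b (letters b v) J, ∀ y ∈ embeddedQuotient b (letters b v) J,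
    BruhatLE b x y ∨ BruhatLE b y x

/-- `w = u v` is the parabolic decomposition of `w` with respect to `J`, that is `u ∈ W_J` and
`v ∈ ᴶW`, and `u` is the maximal element of `W_J` below `w` in the Bruhat order. -/
def IsMaxParabolicDecomposition (J : Set b.support) (w u v : P.weylGroup) : Prop :=
  w = u * v ∧ u ∈ parabolic b J ∧ v ∈ minReps b J ∧
    BruhatLE b u w ∧ ∀ x ∈ parabolic b J, BruhatLE b x w → BruhatLE b x u

/-- `u v` is a BP-decomposition of `w` (of `w` or of its inverse) with respect to `J = S \ {s}`,
where `s` is a leaf of the Dynkin diagram. -/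
def IsBPDecomposition (s : b.support) (w u v : P.weylGroup) : Prop :=
  IsLeaf b s ∧
    (IsMaxParabolicDecomposition b {s}ᶜ w u v ∨ IsMaxParabolicDecomposition b {s}ᶜ w⁻¹ u v)

end WeylBruhat

end

/-! Write N(x) (`negSet`) for the set of positive roots that x⁻¹ makes negative. Both polynomials
are invariant under inversion, so let uv decompose w itself. Then P and R acquire the same factor in
passing from u to w.

For P: since u is the maximum of W_J below w, (a, y) ↦ ay is a length-additive bijection from [1, u]
× ([1, v] ∩ ᴶW) onto [1, w] (`poincarePoly_eq_mul`). The factor is `quotientPoly`.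

For R: every chamber of the arrangement contains a Weyl chamber, so chambers are the sign patterns
that Weyl group elements x induce on the inversion set (`distancePoly_eq_signPoly`). After
inverting, this set is N(w) = N(u) ⊔ u N(v). Fibre the patterns over their restrictions to N(u), and
let K be the set of letters of v. Maximality of u makes each s in K ∩ J a right descent of u, so the
pattern of x on N(u) determines the W_{K∩J}-component c of u⁻¹x. The other signs are those of the
roots in B = c⁻¹N(v), and they depend only on the W_K-component y of c⁻¹u⁻¹x. Every y in the
embedded quotient occurs over a given pattern on N(u); this rests on interpolation in the weak order
(`exists_with_components`). So a fibre over a pattern T contributes q^|T| times `tracePoly` of B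
(`sum_fiber_eq`).

The set B varies with the fibre, but its trace polynomial does not. If v is longest, B is the full
set of quotient roots and the traces are the sets N(y) themselves. In the chain case the sets N(y)
are nested, and their traces on B have each size from 0 to ℓ(v) exactly once. Either way the result
is `quotientPoly`. -/

noncomputable section

set_option linter.unusedSectionVars false

/-! ### Sides of a hyperplane given by a linear form -/

namespace HyperplaneArrangement

variable {V : Type*} [AddCommGroup V] [Module ℝ V]

/-- Strictly on opposite sides of the hyperplane `f = 0` means opposite nonzero signs of `f`. -/
theorem sOppSide_ker_iff (f : Module.Dual ℝ V) (x y : V) :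
    (LinearMap.ker f).toAffineSubspace.SOppSide x y ↔ f x * f y < 0 := by
  have h1 : (LinearMap.ker f).toAffineSubspace.SOppSide x y ↔
      (LinearMap.ker f).toAffineSubspace.SSameSide x (-y) := by
    refine and_congr ?_ (and_congr Iff.rfl ?_)
    · constructor
      · rintro ⟨p, hp, r, hr, h⟩
        refine ⟨p, hp, -r, ?_, ?_⟩
        · simpa using hr
        · simpa [sub_eq_add_neg, add_comm] using h
      · rintro ⟨p, hp, r, hr, h⟩
        refine ⟨p, hp, -r, ?_, ?_⟩
        · simpa using hr
        · simpa [sub_eq_add_neg, add_comm] using h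
    · simp
  rw [h1, sSameSide_ker_iff, map_neg, mul_neg, neg_pos]

end HyperplaneArrangement

namespace WeylBruhat

variable {ι M N : Type*} [Finite ι] [AddCommGroup M] [Module ℝ M] [AddCommGroup N] [Module ℝ N]
  {P : RootPairing ι ℝ M N} [P.IsRootSystem] [P.IsCrystallographic] [P.IsReduced] (b : P.Base)

/-! ### Roots and signs -/

theorem root_smul (g : P.weylGroup) (i : ι) : P.root (g • i) = g • P.root i :=
  (P.weylGroup_apply_root g i).symm

theorem weylGroup_ext {g h : P.weylGroup} (H : ∀ i : ι, g • i = h • i) : g = h := by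
  apply Subtype.ext
  apply RootPairing.Equiv.weightHom_injective P
  apply LinearEquiv.toLinearMap_injective
  refine LinearMap.ext_on_range (RootPairing.IsRootSystem.span_root_eq_top (P := P)) fun i => ?_
  have h1 := root_smul g i
  have h2 := root_smul h i
  rw [H i, h2] at h1
  exact h1.symm

/-- The action of an element of the Weyl group as a linear map. -/
def actLin (g : P.weylGroup) : M →ₗ[ℝ] M :=
  (RootPairing.Equiv.weightHom P (g : P.Aut)).toLinearMap

theorem actLin_root (g : P.weylGroup) (i : ι) : actLin g (P.root i) = P.root (g • i) :=
  (root_smul g i).symm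

theorem ofIdx_smul_index (i j : ι) :
    RootPairing.weylGroup.ofIdx P i • j = P.reflectionPerm i j := rfl

theorem simple_smul (s : b.support) (j : ι) : simple b s • j = P.reflectionPerm s j := rfl

/-- The index of the negative of a root. -/
def opp (P : RootPairing ι ℝ M N) (i : ι) : ι := P.reflectionPerm i i

theorem root_opp (i : ι) : P.root (opp P i) = -P.root i := by simp [opp]

@[simp] theorem opp_opp (i : ι) : opp P (opp P i) = i :=
  P.root.injective (by simp [root_opp])

theorem smul_opp (g : P.weylGroup) (i : ι) : g • opp P i = opp P (g • i) :=
  P.root.injective (by rw [root_opp, ← actLin_root, ← actLin_root, root_opp, map_neg])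

theorem isPos_opp (i : ι) : b.IsPos (opp P i) ↔ ¬ b.IsPos i :=
  RootPairing.Base.IsPos.neg_iff_not b i

theorem ofIdx_smul_self (i : ι) : RootPairing.weylGroup.ofIdx P i • i = opp P i := rfl

theorem simple_smul_self (s : b.support) : simple b s • (s : ι) = opp P s := rfl

theorem isPos_simple (s : b.support) : b.IsPos (s : ι) :=
  RootPairing.Base.isPos_of_mem_support s.2

@[simp] theorem ofIdx_mul_self (i : ι) :
    RootPairing.weylGroup.ofIdx P i * RootPairing.weylGroup.ofIdx P i = 1 :=
  weylGroup_ext fun j => by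
    rw [mul_smul, one_smul, ofIdx_smul_index, ofIdx_smul_index, P.reflectionPerm_self]

@[simp] theorem simple_mul_self (s : b.support) : simple b s * simple b s = 1 := ofIdx_mul_self _

@[simp] theorem simple_inv (s : b.support) : (simple b s)⁻¹ = simple b s :=
  inv_eq_of_mul_eq_one_left (simple_mul_self b s)

@[simp] theorem simple_mul_simple_mul (s : b.support) (x : P.weylGroup) :
    simple b s * (simple b s * x) = x := by rw [← mul_assoc, simple_mul_self, one_mul]

@[simp] theorem mul_simple_mul_simple (s : b.support) (x : P.weylGroup) :
    x * simple b s * simple b s = x := by rw [mul_assoc, simple_mul_self, mul_one]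

@[simp] theorem simple_smul_simple_smul (s : b.support) (i : ι) :
    simple b s • simple b s • i = i := by rw [← mul_smul, simple_mul_self, one_smul]

theorem isPos_simple_smul (s : b.support) {i : ι} (hi : b.IsPos i) (h : i ≠ s) :
    b.IsPos (simple b s • i) :=
  hi.reflectionPerm s.2 h

theorem not_isPos_simple_smul_self (s : b.support) : ¬ b.IsPos (simple b s • (s : ι)) := by
  rw [simple_smul_self, isPos_opp, not_not]
  exact isPos_simple b s

/-- Conjugating a reflection. -/
theorem mul_ofIdx (g : P.weylGroup) (i : ι) :
    g * RootPairing.weylGroup.ofIdx P i = RootPairing.weylGroup.ofIdx P (g • i) * g := by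
  have key : ∀ j i : ι, RootPairing.weylGroup.ofIdx P j * RootPairing.weylGroup.ofIdx P i =
      RootPairing.weylGroup.ofIdx P (RootPairing.weylGroup.ofIdx P j • i) *
        RootPairing.weylGroup.ofIdx P j := by
    intro j i
    refine weylGroup_ext fun k => P.root.injective ?_
    have := P.reflection_reflectionPerm (i := i) (j := j)
    simp only [mul_smul, ofIdx_smul_index, P.root_reflectionPerm, this, LinearEquiv.mul_apply,
      P.reflection_same]
  obtain ⟨g, hg⟩ := g
  induction hg using RootPairing.weylGroup.induction generalizing i with
  | mem j => exact key j i
  | one => exact weylGroup_ext fun k => rfl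
  | mul x y hx hy ihx ihy =>
    have h1 := ihx ((⟨y, hy⟩ : P.weylGroup) • i)
    have h2 := ihy i
    change (⟨x, hx⟩ * ⟨y, hy⟩ : P.weylGroup) * _ = _ * (⟨x, hx⟩ * ⟨y, hy⟩ : P.weylGroup)
    rw [mul_assoc, h2, ← mul_assoc, h1, mul_assoc]
    rfl

theorem ofIdx_opp (i : ι) :
    RootPairing.weylGroup.ofIdx P (opp P i) = RootPairing.weylGroup.ofIdx P i := by
  have := mul_ofIdx (RootPairing.weylGroup.ofIdx P i) i
  rw [ofIdx_smul_self] at this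
  exact (mul_right_cancel this).symm

/-! ### Coefficients -/

/-- The coefficient of a simple root in a vector. -/
def coeff (m : M) (j : b.support) : ℝ := b.toWeightBasis.repr m j

theorem coeff_simple_self (s : b.support) : coeff b (P.root s) s = 1 := by simp [coeff]

theorem coeff_simple_of_ne {s j : b.support} (h : s ≠ j) : coeff b (P.root s) j = 0 := by
  simp [coeff, Finsupp.single_eq_of_ne h.symm]

@[simp] theorem coeff_sub (m m' : M) (j : b.support) :
    coeff b (m - m') j = coeff b m j - coeff b m' j := by simp [coeff]

@[simp] theorem coeff_neg (m : M) (j : b.support) : coeff b (-m) j = -coeff b m j := by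
  simp [coeff]

@[simp] theorem coeff_smul (c : ℝ) (m : M) (j : b.support) :
    coeff b (c • m) j = c * coeff b m j := by simp [coeff]

theorem sum_coeff (m : M) : ∑ j, coeff b m j • P.root j = m := by
  simpa [coeff] using b.toWeightBasis.sum_repr m

/-- The height as a linear form. -/
def ht : M →ₗ[ℝ] ℝ := b.toWeightBasis.constr ℝ fun _ => (1 : ℝ)

theorem ht_simple (s : b.support) : ht b (P.root s) = 1 := by
  have := b.toWeightBasis.constr_basis ℝ (fun _ => (1 : ℝ)) s
  simpa [ht] using this

theorem ht_root (i : ι) : ht b (P.root i) = b.height i := by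
  obtain ⟨f, -, -, hf⟩ := b.exists_root_eq_sum_int i
  rw [RootPairing.Base.height_eq_sum hf, hf, map_sum]
  push_cast
  refine Finset.sum_congr rfl fun j hj => ?_
  rw [map_zsmul, ht_simple b ⟨j, hj⟩]
  simp

theorem isPos_iff_ht (i : ι) : b.IsPos i ↔ 0 < ht b (P.root i) := by
  rw [ht_root, RootPairing.Base.isPos_iff]
  exact Int.cast_pos.symm

theorem isPos_iff_ht' (i : ι) : b.IsPos i ↔ 0 ≤ ht b (P.root i) := by
  rw [ht_root, RootPairing.Base.isPos_iff']
  exact Int.cast_nonneg_iff.symm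

/-- The integral coordinates of a root all have one sign, and the height decides which. -/
theorem coeff_nonneg {i : ι} (hi : b.IsPos i) (j : b.support) : 0 ≤ coeff b (P.root i) j := by
  obtain ⟨f, -, hf0, hf⟩ := b.exists_root_eq_sum_int i
  have hc : coeff b (P.root i) j = f j := by
    have h1 : coeff b (P.root i) j = ∑ k : b.support, f k * coeff b (P.root k) j := by
      rw [hf, ← Finset.sum_coe_sort]
      simp only [coeff, map_sum, Finsupp.coe_finsetSum, Finset.sum_apply,
        ← Int.cast_smul_eq_zsmul ℝ, map_smul, Finsupp.smul_apply, smul_eq_mul]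
    rw [h1, Finset.sum_eq_single j, coeff_simple_self, mul_one]
    · intro k _ hk
      rw [coeff_simple_of_ne b hk, mul_zero]
    · simp
  have hpos : 0 < f := by
    refine hf0.resolve_right fun h => ?_
    have h1 := RootPairing.Base.height_eq_sum hf
    rw [RootPairing.Base.isPos_iff, h1] at hi
    exact absurd hi (not_lt.2 (Finset.sum_nonpos fun i _ => h.le i))
  rw [hc]
  exact_mod_cast hpos.le j

theorem coeff_nonpos {i : ι} (hi : ¬ b.IsPos i) (j : b.support) : coeff b (P.root i) j ≤ 0 := by
  have := coeff_nonneg b ((isPos_opp b i).2 hi) j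
  rw [root_opp, coeff_neg] at this
  linarith

/-- The root `i` is a linear combination of the simple roots in `J`: it belongs to the parabolic
subsystem `Φ_J`. -/
def Supp (J : Set b.support) (i : ι) : Prop := ∀ j ∉ J, coeff b (P.root i) j = 0

variable {b}

theorem Supp.opp {J : Set b.support} {i : ι} (h : Supp b J i) : Supp b J (opp P i) :=
  fun j hj => by rw [root_opp, coeff_neg, h j hj, neg_zero]

theorem supp_opp {J : Set b.support} {i : ι} : Supp b J (WeylBruhat.opp P i) ↔ Supp b J i :=
  ⟨fun h => by simpa using h.opp, Supp.opp⟩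

theorem supp_simple {J : Set b.support} {s : b.support} (h : s ∈ J) : Supp b J (s : ι) :=
  fun j hj => by
    refine coeff_simple_of_ne b ?_
    rintro rfl
    exact hj h

theorem Supp.inter {J K : Set b.support} {i : ι} (h : Supp b J i) (h' : Supp b K i) :
    Supp b (J ∩ K) i := fun j hj => by
  by_cases hJ : j ∈ J
  · exact h' j fun hK => hj ⟨hJ, hK⟩
  · exact h j hJ

theorem Supp.mono {J K : Set b.support} (hJK : J ⊆ K) {i : ι} (h : Supp b J i) : Supp b K i :=
  fun j hj => h j fun hJ => hj (hJK hJ)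

theorem supp_univ (i : ι) : Supp b Set.univ i := fun _ h => absurd (Set.mem_univ _) h

variable (b)

theorem ht_actLin (g : P.weylGroup) (i : ι) :
    ht b (P.root (g • i)) = ∑ j, coeff b (P.root i) j * ht b (P.root (g • (j : ι))) := by
  rw [← actLin_root]
  conv_lhs => rw [← sum_coeff b (P.root i)]
  simp [map_sum, actLin_root]

/-- The height of g α is a nonnegative combination of the heights of the g α_j with j in J. Weak
positivity suffices because no root has height zero. -/
theorem isPos_smul_of_supp {J : Set b.support} {g : P.weylGroup}
    (hg : ∀ j ∈ J, b.IsPos (g • (j : ι))) {i : ι} (hi : b.IsPos i) (hJ : Supp b J i) :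
    b.IsPos (g • i) := by
  rw [isPos_iff_ht', ht_actLin]
  refine Finset.sum_nonneg fun j _ => ?_
  by_cases h : j ∈ J
  · exact mul_nonneg (coeff_nonneg b hi j) ((isPos_iff_ht' b _).1 (hg j h))
  · rw [hJ j h, zero_mul]

theorem not_isPos_smul_of_supp {J : Set b.support} {g : P.weylGroup}
    (hg : ∀ j ∈ J, ¬ b.IsPos (g • (j : ι))) {i : ι} (hi : b.IsPos i) (hJ : Supp b J i) :
    ¬ b.IsPos (g • i) := by
  rw [isPos_iff_ht, ht_actLin, not_lt]
  refine Finset.sum_nonpos fun j _ => ?_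
  by_cases h : j ∈ J
  · exact mul_nonpos_of_nonneg_of_nonpos (coeff_nonneg b hi j)
      (not_lt.1 ((isPos_iff_ht b _).not.1 (hg j h)))
  · rw [hJ j h, zero_mul]

/-! ### Words, length and the exchange property -/

@[simp] theorem wordProd_nil : wordProd b [] = 1 := rfl

@[simp] theorem wordProd_cons (s : b.support) (l : List b.support) :
    wordProd b (s :: l) = simple b s * wordProd b l := by simp [wordProd]

@[simp] theorem wordProd_append (l l' : List b.support) :
    wordProd b (l ++ l') = wordProd b l * wordProd b l' := by simp [wordProd]

theorem wordProd_reverse (l : List b.support) : wordProd b l.reverse = (wordProd b l)⁻¹ := by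
  induction l with
  | nil => simp
  | cons s l ih => simp [ih]

theorem ofIdx_eq_wordProd (i : ι) : ∃ l, wordProd b l = RootPairing.weylGroup.ofIdx P i := by
  induction i using b.induction_reflect with
  | h₀ i hi =>
    obtain ⟨l, hl⟩ := hi
    exact ⟨l, hl.trans (ofIdx_opp i).symm⟩
  | h₁ i hi => exact ⟨[⟨i, hi⟩], by simp [wordProd, simple]⟩
  | h₂ i j hi hj =>
    obtain ⟨l, hl⟩ := hi
    refine ⟨⟨j, hj⟩ :: (l ++ [⟨j, hj⟩]), ?_⟩
    have := mul_ofIdx (simple b ⟨j, hj⟩) i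
    rw [wordProd_cons, wordProd_append, hl, ← mul_assoc, this]
    simp [wordProd]
    rfl

theorem exists_wordProd (w : P.weylGroup) : ∃ l, wordProd b l = w := by
  obtain ⟨w, hw⟩ := w
  induction hw using RootPairing.weylGroup.induction with
  | mem i => exact ofIdx_eq_wordProd b i
  | one => exact ⟨[], rfl⟩
  | mul x y hx hy ihx ihy =>
    obtain ⟨l, hl⟩ := ihx
    obtain ⟨l', hl'⟩ := ihy
    exact ⟨l ++ l', by rw [wordProd_append, hl, hl']; rfl⟩

theorem exists_reduced (w : P.weylGroup) : ∃ l, wordProd b l = w ∧ l.length = length b w := by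
  obtain ⟨l, hl⟩ := exists_wordProd b w
  obtain ⟨l', h1, h2⟩ := Nat.sInf_mem
    (s := {n | ∃ l : List b.support, l.length = n ∧ wordProd b l = w}) ⟨_, l, rfl, hl⟩
  exact ⟨l', h2, h1⟩

theorem length_wordProd_le (l : List b.support) : length b (wordProd b l) ≤ l.length :=
  Nat.sInf_le ⟨l, rfl, rfl⟩

/-- The strong exchange property. -/
theorem strong_exchange {l : List b.support} {i : ι} (hi : b.IsPos i)
    (h : ¬ b.IsPos (wordProd b l • i)) :
    ∃ l' : List b.support, l'.Sublist l ∧ l'.length + 1 = l.length ∧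
      wordProd b l' = wordProd b l * RootPairing.weylGroup.ofIdx P i := by
  induction l with
  | nil => simp [hi] at h
  | cons s l ih =>
    by_cases hl : b.IsPos (wordProd b l • i)
    · have hs : wordProd b l • i = s := by
        by_contra hne
        exact h (by rw [wordProd_cons, mul_smul]; exact isPos_simple_smul b s hl hne)
      refine ⟨l, List.sublist_cons_self _ _, rfl, ?_⟩
      rw [wordProd_cons, mul_assoc, mul_ofIdx, hs]
      exact (simple_mul_simple_mul b s _).symm
    · obtain ⟨l', h1, h2, h3⟩ := ih hl
      exact ⟨s :: l', h1.cons_cons s, by simp [h2], by rw [wordProd_cons, wordProd_cons, h3, mul_assoc]⟩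

@[simp] theorem length_one : length b (1 : P.weylGroup) = 0 :=
  Nat.le_zero.1 (length_wordProd_le b [])

theorem eq_one_of_length {w : P.weylGroup} (h : length b w = 0) : w = 1 := by
  obtain ⟨l, h1, h2⟩ := exists_reduced b w
  rw [h, List.length_eq_zero_iff] at h2
  rw [← h1, h2, wordProd_nil]

@[simp] theorem length_inv (w : P.weylGroup) : length b w⁻¹ = length b w := by
  have key : ∀ w : P.weylGroup, length b w⁻¹ ≤ length b w := fun w => by
    obtain ⟨l, h1, h2⟩ := exists_reduced b w
    rw [← h2, ← h1, ← wordProd_reverse, ← List.length_reverse]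
    exact length_wordProd_le b _
  exact le_antisymm (key w) (by simpa using key w⁻¹)

theorem length_mul_le (x y : P.weylGroup) : length b (x * y) ≤ length b x + length b y := by
  obtain ⟨l, h1, h2⟩ := exists_reduced b x
  obtain ⟨l', h3, h4⟩ := exists_reduced b y
  rw [← h2, ← h4, ← h1, ← h3, ← wordProd_append, ← List.length_append]
  exact length_wordProd_le b _

theorem length_simple_le (s : b.support) : length b (simple b s) ≤ 1 := by
  simpa [wordProd] using length_wordProd_le b [s]

theorem length_mul_ofIdx_lt {w : P.weylGroup} {i : ι} (hi : b.IsPos i) (h : ¬ b.IsPos (w • i)) :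
    length b (w * RootPairing.weylGroup.ofIdx P i) < length b w := by
  obtain ⟨l, rfl, h2⟩ := exists_reduced b w
  obtain ⟨l', -, h3, h4⟩ := strong_exchange b hi h
  rw [← h4, ← h2, ← h3]
  exact Nat.lt_succ_of_le (length_wordProd_le b _)

theorem length_lt_mul_ofIdx {w : P.weylGroup} {i : ι} (hi : b.IsPos i) (h : b.IsPos (w • i)) :
    length b w < length b (w * RootPairing.weylGroup.ofIdx P i) := by
  have h' : ¬ b.IsPos ((w * RootPairing.weylGroup.ofIdx P i) • i) := by
    rw [mul_smul, ofIdx_smul_self, smul_opp, isPos_opp, not_not]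
    exact h
  simpa [mul_assoc] using length_mul_ofIdx_lt b hi h'

theorem length_lt_mul_ofIdx_iff {w : P.weylGroup} {i : ι} (hi : b.IsPos i) :
    length b w < length b (w * RootPairing.weylGroup.ofIdx P i) ↔ b.IsPos (w • i) :=
  ⟨fun h => by_contra fun h' => lt_asymm h (length_mul_ofIdx_lt b hi h'),
    length_lt_mul_ofIdx b hi⟩

theorem length_mul_simple {w : P.weylGroup} {s : b.support} (h : b.IsPos (w • (s : ι))) :
    length b (w * simple b s) = length b w + 1 := by
  have h1 := length_lt_mul_ofIdx b (isPos_simple b s) h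
  have h2 := length_mul_le b w (simple b s)
  have h3 := length_simple_le b s
  change length b w < length b (w * simple b s) at h1
  omega

theorem length_mul_simple_neg {w : P.weylGroup} {s : b.support} (h : ¬ b.IsPos (w • (s : ι))) :
    length b (w * simple b s) + 1 = length b w := by
  have := length_mul_simple b (w := w * simple b s) (s := s) (by
    rw [mul_smul, simple_smul_self, smul_opp, isPos_opp]; exact h)
  rw [← this, mul_simple_mul_simple]

theorem length_simple_mul {w : P.weylGroup} {s : b.support} (h : b.IsPos (w⁻¹ • (s : ι))) :
    length b (simple b s * w) = length b w + 1 := by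
  rw [← length_inv, mul_inv_rev, simple_inv, length_mul_simple b h, length_inv]

theorem length_simple_mul_neg {w : P.weylGroup} {s : b.support}
    (h : ¬ b.IsPos (w⁻¹ • (s : ι))) : length b (simple b s * w) + 1 = length b w := by
  rw [← length_inv, mul_inv_rev, simple_inv, length_mul_simple_neg b h, length_inv]

/-! ### The sets of negated roots -/

/-- The positive roots `i` such that `x⁻¹ i` is negative. -/
def negSet (x : P.weylGroup) : Set ι := {i | b.IsPos i ∧ ¬ b.IsPos (x⁻¹ • i)}

theorem inversionSet_eq (w : P.weylGroup) : inversionSet b w = negSet b w⁻¹ := by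
  simp only [inversionSet, negSet, inv_inv]
  rfl

@[simp] theorem negSet_one : negSet b (1 : P.weylGroup) = ∅ := by
  ext i; simp [negSet]

theorem negSet_mul_simple {x : P.weylGroup} {s : b.support} (h : b.IsPos (x • (s : ι))) :
    negSet b (x * simple b s) = insert (x • (s : ι)) (negSet b x) := by
  ext i
  simp only [negSet, mem_ofPred_eq, mem_insert_iff, mul_inv_rev, simple_inv, mul_smul]
  constructor
  · rintro ⟨h1, h2⟩
    by_cases h3 : b.IsPos (x⁻¹ • i)
    · left
      by_contra hne
      exact h2 (isPos_simple_smul b s h3 fun h => hne (by rw [← h, smul_inv_smul]))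
    · exact Or.inr ⟨h1, h3⟩
  · rintro (rfl | ⟨h1, h2⟩)
    · rw [inv_smul_smul]
      exact ⟨h, not_isPos_simple_smul_self b s⟩
    · refine ⟨h1, ?_⟩
      rw [← isPos_opp, ← smul_opp]
      refine isPos_simple_smul b s ((isPos_opp b _).2 h2) fun h' => ?_
      have : i = opp P (x • (s : ι)) := by rw [← smul_opp, ← h', opp_opp, smul_inv_smul]
      rw [this, isPos_opp] at h1
      exact h1 h

/-- Each letter of a reduced word adds exactly one root to the set. -/
theorem ncard_negSet (x : P.weylGroup) : (negSet b x).ncard = length b x := by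
  generalize hn : length b x = n
  induction n generalizing x with
  | zero => rw [eq_one_of_length b hn]; simp
  | succ n ih =>
    obtain ⟨l, h1, h2⟩ := exists_reduced b x
    obtain rfl | ⟨l, s, rfl⟩ := l.eq_nil_or_concat'
    · simp [hn] at h2
    · rw [wordProd_append] at h1
      have h1 : wordProd b l * simple b s = x := by simpa [wordProd] using h1
      have hl := length_wordProd_le b l
      have hx : length b (wordProd b l) = n := by
        have := length_mul_le b (wordProd b l) (simple b s)
        have := length_simple_le b s
        rw [h1] at *
        simp at h2
        omega
      have hp : b.IsPos (wordProd b l • (s : ι)) := by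
        by_contra h
        have := length_mul_simple_neg b h
        rw [h1] at this
        omega
      rw [← h1, negSet_mul_simple b hp, Set.ncard_insert_of_notMem _ (Set.toFinite _), ih _ hx]
      simp [negSet, isPos_simple b s]

theorem exists_descent {x : P.weylGroup} (h : x ≠ 1) : ∃ s : b.support, ¬ b.IsPos (x⁻¹ • (s : ι)) := by
  obtain ⟨l, h1, h2⟩ := exists_reduced b x
  cases l with
  | nil => exact absurd h1.symm h
  | cons s l =>
    refine ⟨s, fun hs => ?_⟩
    have h3 := length_simple_mul b hs
    rw [← h1, wordProd_cons, simple_mul_simple_mul, ← wordProd_cons, h1, ← h2] at h3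
    have := length_wordProd_le b l
    simp at h3
    omega

/-- One step in the weak order. -/
theorem exists_weak_step {z a : P.weylGroup} (h : negSet b z ⊆ negSet b a) (hne : z ≠ a) :
    ∃ s : b.support, b.IsPos (z • (s : ι)) ∧ negSet b (z * simple b s) ⊆ negSet b a := by
  obtain ⟨s, hs⟩ := exists_descent b (x := z⁻¹ * a) (by rwa [Ne, inv_mul_eq_one])
  rw [mul_inv_rev, inv_inv, mul_smul] at hs
  have hpos : b.IsPos (z • (s : ι)) := by
    by_contra hn
    have h1 : opp P (z • (s : ι)) ∈ negSet b z :=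
      ⟨(isPos_opp b _).2 hn, by
        rw [← smul_opp, inv_smul_smul, isPos_opp, not_not]; exact isPos_simple b s⟩
    have h2 := (h h1).2
    rw [smul_opp, isPos_opp, not_not] at h2
    exact hs h2
  refine ⟨s, hpos, ?_⟩
  rw [negSet_mul_simple b hpos]
  exact Set.insert_subset ⟨hpos, hs⟩ h

/-- If x and y differed, a weak step up from x would put ℓ(x) + 1 roots inside N(y). -/
theorem negSet_subset_antisymm {x y : P.weylGroup} (h : negSet b x ⊆ negSet b y)
    (h' : length b y ≤ length b x) : x = y := by
  by_contra hne
  obtain ⟨s, h1, h2⟩ := exists_weak_step b h hne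
  have := Set.ncard_le_ncard h2
  rw [ncard_negSet, ncard_negSet, length_mul_simple b h1] at this
  omega

theorem negSet_injective : Function.Injective (negSet b) := fun x y h =>
  negSet_subset_antisymm b h.le (by rw [← ncard_negSet, ← ncard_negSet, h])

/-! ### Parabolic subgroups -/

theorem simple_mem_parabolic {J : Set b.support} {s : b.support} (h : s ∈ J) :
    simple b s ∈ parabolic b J :=
  Subgroup.subset_closure (Set.mem_image_of_mem _ h)

theorem mem_parabolic_iff {J : Set b.support} {w : P.weylGroup} :
    w ∈ parabolic b J ↔ ∃ l : List b.support, (∀ s ∈ l, s ∈ J) ∧ wordProd b l = w := by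
  constructor
  · intro h
    induction h using Subgroup.closure_induction with
    | mem x hx =>
      obtain ⟨s, hs, rfl⟩ := hx
      exact ⟨[s], by simpa using hs, by simp⟩
    | one => exact ⟨[], by simp, rfl⟩
    | mul x y _ _ hx hy =>
      obtain ⟨l, h1, rfl⟩ := hx
      obtain ⟨l', h2, rfl⟩ := hy
      refine ⟨l ++ l', fun s hs => ?_, wordProd_append b l l'⟩
      rcases List.mem_append.1 hs with hs | hs
      · exact h1 s hs
      · exact h2 s hs
    | inv x _ hx =>
      obtain ⟨l, h1, rfl⟩ := hx
      exact ⟨l.reverse, fun s hs => h1 s (List.mem_reverse.1 hs), wordProd_reverse b l⟩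
  · rintro ⟨l, h, rfl⟩
    induction l with
    | nil => exact one_mem _
    | cons s l ih =>
      rw [wordProd_cons]
      exact mul_mem (simple_mem_parabolic b (h s (by simp)))
        (ih fun t ht => h t (List.mem_cons_of_mem _ ht))

theorem parabolic_mono {J K : Set b.support} (h : J ⊆ K) : parabolic b J ≤ parabolic b K :=
  Subgroup.closure_mono (Set.image_mono h)

theorem coeff_smul_of_mem_parabolic {J : Set b.support} {w : P.weylGroup}
    (hw : w ∈ parabolic b J) (i : ι) {j : b.support} (hj : j ∉ J) :
    coeff b (P.root (w • i)) j = coeff b (P.root i) j := by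
  obtain ⟨l, hl, rfl⟩ := (mem_parabolic_iff b).1 hw
  clear hw
  induction l with
  | nil => simp
  | cons s l ih =>
    rw [wordProd_cons, mul_smul, simple_smul, P.root_reflectionPerm, P.reflection_apply,
      coeff_sub, coeff_smul, coeff_simple_of_ne, mul_zero, sub_zero]
    · exact ih fun t ht => hl t (List.mem_cons_of_mem _ ht)
    · rintro rfl
      exact hj (hl s (by simp))

variable {b} in
theorem supp_smul {J : Set b.support} {w : P.weylGroup} (hw : w ∈ parabolic b J) {i : ι} :
    Supp b J (w • i) ↔ Supp b J i :=
  forall₂_congr fun j hj => by rw [coeff_smul_of_mem_parabolic b hw i hj]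

-- W_J leaves the coordinates outside J unchanged, and a positive root outside Φ_J has a positive
-- one among them.
variable {b} in
theorem isPos_smul_of_not_supp {J : Set b.support} {w : P.weylGroup} (hw : w ∈ parabolic b J)
    {i : ι} (hi : b.IsPos i) (hJ : ¬ Supp b J i) : b.IsPos (w • i) := by
  by_contra h
  refine hJ fun j hj => le_antisymm ?_ (coeff_nonneg b hi j)
  rw [← coeff_smul_of_mem_parabolic b hw i hj]
  exact coeff_nonpos b h j

variable {b} in
theorem supp_of_mem_negSet {J : Set b.support} {w : P.weylGroup} (hw : w ∈ parabolic b J)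
    {i : ι} (hi : i ∈ negSet b w) : Supp b J i :=
  by_contra fun h => hi.2 (isPos_smul_of_not_supp (inv_mem hw) hi.1 h)

theorem supp_simple_iff {J : Set b.support} {s : b.support} : Supp b J (s : ι) ↔ s ∈ J := by
  refine ⟨fun h => ?_, supp_simple⟩
  by_contra hs
  simpa [coeff_simple_self] using h s hs

/-- Left descents of w lie in J and can be peeled off one at a time; x keeps each of the positive
roots of Φ_J involved positive, so each is also a descent of the product. -/
theorem length_mul_of_isPos {J : Set b.support} {w x : P.weylGroup} (hw : w ∈ parabolic b J)
    (hx : ∀ j ∈ J, b.IsPos (x⁻¹ • (j : ι))) :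
    length b (w * x) = length b w + length b x := by
  generalize hn : length b w = n
  induction n generalizing w with
  | zero => rw [eq_one_of_length b hn, one_mul, zero_add]
  | succ n ih =>
    have hne : w ≠ 1 := fun h => by rw [h, length_one] at hn; omega
    obtain ⟨s, hs⟩ := exists_descent b hne
    have hsJ : s ∈ J := (supp_simple_iff b).1 (supp_of_mem_negSet hw ⟨isPos_simple b s, hs⟩)
    have hmem : simple b s * w ∈ parabolic b J := mul_mem (simple_mem_parabolic b hsJ) hw
    have h1 := length_simple_mul_neg b hs
    have h2 : b.IsPos ((simple b s * w)⁻¹ • (s : ι)) := by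
      rwa [mul_inv_rev, simple_inv, mul_smul, simple_smul_self, smul_opp, isPos_opp]
    have h3 : b.IsPos ((simple b s * w * x)⁻¹ • (s : ι)) := by
      rw [mul_inv_rev, mul_smul]
      exact isPos_smul_of_supp b hx h2 ((supp_smul (inv_mem hmem)).2 (supp_simple hsJ))
    have h4 := length_simple_mul b h3
    rw [mul_assoc, simple_mul_simple_mul, ← mul_assoc, ih hmem (by omega)] at h4
    omega

theorem mem_minReps_iff {J : Set b.support} {x : P.weylGroup} :
    x ∈ minReps b J ↔ ∀ j ∈ J, b.IsPos (x⁻¹ • (j : ι)) := by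
  constructor
  · intro h j hj
    by_contra hn
    have h1 := h _ (simple_mem_parabolic b hj)
    have h2 := length_simple_mul_neg b hn
    omega
  · intro h y hy
    rw [length_mul_of_isPos b hy h]
    omega

theorem isPos_of_mem_minReps {J : Set b.support} {x : P.weylGroup} (hx : x ∈ minReps b J) {i : ι}
    (hi : b.IsPos i) (hJ : Supp b J i) : b.IsPos (x⁻¹ • i) :=
  isPos_smul_of_supp b ((mem_minReps_iff b).1 hx) hi hJ

theorem length_mul_of_mem_minReps {J : Set b.support} {a y : P.weylGroup}
    (ha : a ∈ parabolic b J) (hy : y ∈ minReps b J) :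
    length b (a * y) = length b a + length b y :=
  length_mul_of_isPos b ha ((mem_minReps_iff b).1 hy)

theorem exists_parabolic_decomposition (J : Set b.support) (x : P.weylGroup) :
    ∃ a ∈ parabolic b J, ∃ y ∈ minReps b J, x = a * y := by
  obtain ⟨c, hc, hmin⟩ := Set.exists_min_image (parabolic b J : Set P.weylGroup)
    (fun c => length b (c * x)) (Set.toFinite _) ⟨1, one_mem _⟩
  refine ⟨c⁻¹, inv_mem hc, c * x, fun y hy => ?_, by group⟩
  rw [← mul_assoc]
  exact hmin _ (mul_mem hy hc)

theorem isPos_mul_inv_smul_iff {J : Set b.support} {a y : P.weylGroup} (ha : a ∈ parabolic b J)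
    (hy : y ∈ minReps b J) {i : ι} (hi : Supp b J i) :
    b.IsPos ((a * y)⁻¹ • i) ↔ b.IsPos (a⁻¹ • i) := by
  have hs : Supp b J (a⁻¹ • i) := (supp_smul (inv_mem ha)).2 hi
  rw [mul_inv_rev, mul_smul]
  refine ⟨fun h => by_contra fun hn => ?_, fun h => isPos_of_mem_minReps b hy h hs⟩
  have := isPos_of_mem_minReps b hy ((isPos_opp b _).2 hn) hs.opp
  rw [smul_opp, isPos_opp] at this
  exact this h

/-- The minimal representative y changes no sign on Φ_J. Hence the parabolic factor can be read off
from N(ay), which yields uniqueness of the decomposition. -/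
theorem negSet_eq_of_mul {J : Set b.support} {a y : P.weylGroup} (ha : a ∈ parabolic b J)
    (hy : y ∈ minReps b J) : negSet b a = {i ∈ negSet b (a * y) | Supp b J i} := by
  ext i
  constructor
  · intro h
    have hs := supp_of_mem_negSet ha h
    exact ⟨⟨h.1, by rw [isPos_mul_inv_smul_iff b ha hy hs]; exact h.2⟩, hs⟩
  · rintro ⟨⟨h1, h2⟩, hs⟩
    exact ⟨h1, by rwa [isPos_mul_inv_smul_iff b ha hy hs] at h2⟩

theorem parabolic_decomposition_unique {J : Set b.support} {a y a' y' : P.weylGroup}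
    (ha : a ∈ parabolic b J) (hy : y ∈ minReps b J) (ha' : a' ∈ parabolic b J)
    (hy' : y' ∈ minReps b J) (h : a * y = a' * y') : a = a' ∧ y = y' := by
  have h1 : a = a' := negSet_injective b (by
    rw [negSet_eq_of_mul b ha hy, negSet_eq_of_mul b ha' hy', h])
  subst h1
  exact ⟨rfl, mul_left_cancel h⟩

theorem mem_parabolic_of_negSet {J : Set b.support} {x : P.weylGroup}
    (h : ∀ i ∈ negSet b x, Supp b J i) : x ∈ parabolic b J := by
  obtain ⟨a, ha, y, hy, rfl⟩ := exists_parabolic_decomposition b J x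
  have : a = a * y := negSet_injective b (by
    rw [negSet_eq_of_mul b ha hy]
    exact Set.sep_eq_self_iff_mem_true.2 h)
  rwa [← this]

theorem exists_longest (J : Set b.support) :
    ∃ w ∈ parabolic b J, negSet b w = {i | b.IsPos i ∧ Supp b J i} := by
  obtain ⟨w, hw, hmax⟩ := Set.exists_max_image (parabolic b J : Set P.weylGroup)
    (fun c => length b c) (Set.toFinite _) ⟨1, one_mem _⟩
  refine ⟨w, hw, ?_⟩
  ext i
  refine ⟨fun h => ⟨h.1, supp_of_mem_negSet hw h⟩, fun ⟨h1, h2⟩ => ⟨h1, ?_⟩⟩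
  refine not_isPos_smul_of_supp b (fun j hj hpos => ?_) h1 h2
  have h3 := hmax _ (mul_mem (simple_mem_parabolic b hj) hw)
  have h4 := length_simple_mul b hpos
  omega

/-- The longest element of a parabolic subgroup reverses the signs of the roots of `Φ_J`. -/
theorem isPos_inv_smul_of_longest {J : Set b.support} {w : P.weylGroup}
    (h : negSet b w = {i | b.IsPos i ∧ Supp b J i}) {i : ι} (hi : Supp b J i) :
    b.IsPos (w⁻¹ • i) ↔ ¬ b.IsPos i := by
  have key : ∀ i, Supp b J i → b.IsPos i → ¬ b.IsPos (w⁻¹ • i) := fun i h1 h2 => by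
    have : i ∈ negSet b w := by rw [h]; exact ⟨h2, h1⟩
    exact this.2
  refine ⟨fun h1 h2 => key i hi h2 h1, fun h1 => ?_⟩
  have := key _ hi.opp ((isPos_opp b i).2 h1)
  rwa [smul_opp, isPos_opp, not_not] at this

/-! ### Interpolation in the weak order -/

/-- A common upper bound of `z s` and `z t` lies above `z w₀(s, t)`. -/
theorem exists_join_simple {z : P.weylGroup} {s t : b.support} (hs : b.IsPos (z • (s : ι)))
    (ht : b.IsPos (z • (t : ι))) :
    ∃ j, negSet b (z * simple b s) ⊆ negSet b j ∧ negSet b (z * simple b t) ⊆ negSet b j ∧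
      ∀ A, negSet b (z * simple b s) ⊆ negSet b A → negSet b (z * simple b t) ⊆ negSet b A →
        negSet b j ⊆ negSet b A := by
  obtain ⟨w, hw, hN⟩ := exists_longest b ({s, t} : Set b.support)
  have hz : ∀ r ∈ ({s, t} : Set b.support), b.IsPos (z • (r : ι)) := by
    rintro r (rfl | rfl)
    exacts [hs, ht]
  have hmem : ∀ i, i ∈ negSet b (z * w) ↔
      i ∈ negSet b z ∨ ∃ k, b.IsPos k ∧ Supp b {s, t} k ∧ i = z • k := by
    intro i
    simp only [negSet, mem_ofPred_eq, mul_inv_rev, mul_smul]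
    by_cases hsupp : Supp b {s, t} (z⁻¹ • i)
    · rw [isPos_inv_smul_of_longest b hN hsupp, not_not]
      constructor
      · rintro ⟨h1, h2⟩
        exact Or.inr ⟨_, h2, hsupp, (smul_inv_smul _ _).symm⟩
      · rintro (⟨h1, h2⟩ | ⟨k, h1, h2, rfl⟩)
        · exfalso
          have := isPos_smul_of_supp b hz ((isPos_opp b _).2 h2) hsupp.opp
          rw [smul_opp, smul_inv_smul, isPos_opp] at this
          exact this h1
        · rw [inv_smul_smul]
          exact ⟨isPos_smul_of_supp b hz h1 h2, h1⟩
    · constructor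
      · rintro ⟨h1, h2⟩
        exact Or.inl ⟨h1, fun h3 => h2 (isPos_smul_of_not_supp (inv_mem hw) h3 hsupp)⟩
      · rintro (⟨h1, h2⟩ | ⟨k, h1, h2, rfl⟩)
        · refine ⟨h1, ?_⟩
          have := isPos_smul_of_not_supp (inv_mem hw) ((isPos_opp b _).2 h2)
            (fun h => hsupp (supp_opp.1 h))
          rwa [smul_opp, isPos_opp] at this
        · exact absurd (by rwa [inv_smul_smul]) hsupp
  refine ⟨z * w, ?_, ?_, fun A hA hA' => ?_⟩
  · rw [negSet_mul_simple b hs]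
    exact Set.insert_subset ((hmem _).2 (Or.inr ⟨s, isPos_simple b s, supp_simple (by simp), rfl⟩))
      fun i hi => (hmem _).2 (Or.inl hi)
  · rw [negSet_mul_simple b ht]
    exact Set.insert_subset ((hmem _).2 (Or.inr ⟨t, isPos_simple b t, supp_simple (by simp), rfl⟩))
      fun i hi => (hmem _).2 (Or.inl hi)
  · rw [negSet_mul_simple b hs, Set.insert_subset_iff] at hA
    rw [negSet_mul_simple b ht, Set.insert_subset_iff] at hA'
    intro i hi
    rcases (hmem i).1 hi with h | ⟨k, h1, h2, rfl⟩
    · exact hA.2 h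
    · refine ⟨isPos_smul_of_supp b hz h1 h2, ?_⟩
      rw [← mul_smul]
      refine not_isPos_smul_of_supp b ?_ h1 h2
      rintro r (rfl | rfl)
      · rw [mul_smul]; exact hA.1.2
      · rw [mul_smul]; exact hA'.1.2

/-- In the weak order, two elements below two upper bounds can be interpolated. -/
theorem exists_weak_interpolation {a d A D : P.weylGroup}
    (haA : negSet b a ⊆ negSet b A) (haD : negSet b a ⊆ negSet b D)
    (hdA : negSet b d ⊆ negSet b A) (hdD : negSet b d ⊆ negSet b D) :
    ∃ w, negSet b a ⊆ negSet b w ∧ negSet b d ⊆ negSet b w ∧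
      negSet b w ⊆ negSet b A ∧ negSet b w ⊆ negSet b D := by
  -- Induction on the colength of a common lower bound z of a and d, starting from the identity.
  suffices H : ∀ (n : ℕ) (z a d : P.weylGroup), Nat.card ι - length b z = n →
      negSet b z ⊆ negSet b a → negSet b z ⊆ negSet b d →
      negSet b a ⊆ negSet b A → negSet b a ⊆ negSet b D →
      negSet b d ⊆ negSet b A → negSet b d ⊆ negSet b D →
      ∃ w, negSet b a ⊆ negSet b w ∧ negSet b d ⊆ negSet b w ∧
        negSet b w ⊆ negSet b A ∧ negSet b w ⊆ negSet b D from
    H _ 1 a d rfl (by simp) (by simp) haA haD hdA hdD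
  clear haA haD hdA hdD a d
  intro n
  induction n using Nat.strong_induction_on with
  | _ n ih =>
  intro z a d hn hza hzd haA haD hdA hdD
  have hlt : ∀ s : b.support, b.IsPos (z • (s : ι)) →
      Nat.card ι - length b (z * simple b s) < n := fun s hs => by
    have h1 := length_mul_simple b hs
    have h2 := Set.ncard_le_card (negSet b (z * simple b s))
    rw [ncard_negSet] at h2
    omega
  by_cases h1 : z = a
  · subst h1; exact ⟨d, hzd, le_rfl, hdA, hdD⟩
  by_cases h2 : z = d
  · subst h2; exact ⟨a, le_rfl, hza, haA, haD⟩
  obtain ⟨s, hs, hsa⟩ := exists_weak_step b hza h1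
  obtain ⟨t, ht, htd⟩ := exists_weak_step b hzd h2
  -- The join j of zs and zt lies below A and D. Interpolating a with j over zs gives w1, which is
  -- above zt; interpolating w1 with d over zt finishes.
  obtain ⟨j, hj1, hj2, hj3⟩ := exists_join_simple b hs ht
  obtain ⟨w1, h3, h4, h5, h6⟩ := ih _ (hlt s hs) (z * simple b s) a j rfl hsa hj1 haA haD
    (hj3 A (hsa.trans haA) (htd.trans hdA)) (hj3 D (hsa.trans haD) (htd.trans hdD))
  obtain ⟨w2, h7, h8, h9, h10⟩ := ih _ (hlt t ht) (z * simple b t) w1 d rfl (hj2.trans h4) htd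
    h5 h6 hdA hdD
  exact ⟨w2, h3.trans h7, h8, h9, h10⟩

/-- The element whose set of negated roots is `N(a)` together with all positive roots that do not
belong to `Φ_J`. -/
theorem exists_negSet_union {J : Set b.support} {a : P.weylGroup} (ha : a ∈ parabolic b J) :
    ∃ A, negSet b A = negSet b a ∪ {i | b.IsPos i ∧ ¬ Supp b J i} := by
  obtain ⟨w, hw, hN⟩ := exists_longest b J
  obtain ⟨w', -, hN'⟩ := exists_longest b (Set.univ : Set b.support)
  -- Here w and w' are the longest elements of W_J and W: on Φ_J their two sign reversals cancel,
  -- while outside Φ_J only that of w' acts.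
  refine ⟨a * (w * w'), ?_⟩
  ext i
  simp only [negSet, mem_ofPred_eq, mem_union, mul_inv_rev, mul_smul,
    isPos_inv_smul_of_longest b hN' (supp_univ _), not_not]
  by_cases hs : Supp b J i
  · rw [isPos_inv_smul_of_longest b hN ((supp_smul (inv_mem ha)).2 hs)]
    simp [hs]
  · simp only [hs, not_false_eq_true, and_true]
    constructor
    · exact fun h => Or.inr h.1
    · rintro (h | h)
      · exact absurd (isPos_smul_of_not_supp (inv_mem ha) h.1 hs) h.2
      · exact ⟨h, isPos_smul_of_not_supp (inv_mem hw) (isPos_smul_of_not_supp (inv_mem ha) h hs)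
          fun h' => hs ((supp_smul (inv_mem ha)).1 h')⟩

/-- An element with prescribed components in two parabolic subgroups. -/
theorem exists_with_components {J K : Set b.support} {a d : P.weylGroup}
    (ha : a ∈ parabolic b J) (hd : d ∈ parabolic b K)
    (haK : ∀ i ∈ negSet b a, ¬ Supp b K i) (hdJ : ∀ i ∈ negSet b d, ¬ Supp b J i) :
    ∃ w, (∀ i, Supp b J i → (i ∈ negSet b w ↔ i ∈ negSet b a)) ∧
      (∀ i, Supp b K i → (i ∈ negSet b w ↔ i ∈ negSet b d)) := by
  obtain ⟨A, hA⟩ := exists_negSet_union b ha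
  obtain ⟨D, hD⟩ := exists_negSet_union b hd
  -- The upper bounds A and D have the prescribed traces on Φ_J and Φ_K and contain all positive
  -- roots elsewhere, so any w above a and d and below both has the required components.
  obtain ⟨w, h1, h2, h3, h4⟩ := exists_weak_interpolation b (a := a) (d := d) (A := A) (D := D)
    (by rw [hA]; exact Set.subset_union_left)
    (by rw [hD]; exact fun i hi => Or.inr ⟨hi.1, haK i hi⟩)
    (by rw [hA]; exact fun i hi => Or.inr ⟨hi.1, hdJ i hi⟩)
    (by rw [hD]; exact Set.subset_union_left)
  rw [hA] at h3
  rw [hD] at h4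
  exact ⟨w, fun i hi => ⟨fun h => (h3 h).resolve_right fun h' => h'.2 hi, fun h => h1 h⟩,
    fun i hi => ⟨fun h => (h4 h).resolve_right fun h' => h'.2 hi, fun h => h2 h⟩⟩

/-! ### The Bruhat order -/

theorem isReflection_ofIdx (i : ι) : IsReflection b (RootPairing.weylGroup.ofIdx P i) := by
  obtain ⟨g, s, hs⟩ : ∃ (g : P.weylGroup) (s : b.support), i = g • (s : ι) := by
    induction i using b.induction_reflect with
    | h₀ i hi =>
      obtain ⟨g, s, rfl⟩ := hi
      exact ⟨RootPairing.weylGroup.ofIdx P (g • (s : ι)) * g, s, by rw [mul_smul]; rfl⟩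
    | h₁ i hi => exact ⟨1, ⟨i, hi⟩, (one_smul _ _).symm⟩
    | h₂ i j hi hj =>
      obtain ⟨g, s, rfl⟩ := hi
      exact ⟨RootPairing.weylGroup.ofIdx P j * g, s, by rw [mul_smul]; rfl⟩
  exact ⟨g, s, by rw [hs, simple, mul_ofIdx, mul_inv_cancel_right]⟩

theorem IsReflection.conj {t : P.weylGroup} (ht : IsReflection b t) (g : P.weylGroup) :
    IsReflection b (g * t * g⁻¹) := by
  obtain ⟨w, s, rfl⟩ := ht
  exact ⟨g * w, s, by group⟩

/-- The covering-type relation generating the Bruhat order. -/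
def BruhatStep (x y : P.weylGroup) : Prop :=
  ∃ t, IsReflection b t ∧ y = x * t ∧ length b x < length b y

theorem bruhatStep_iff {x y : P.weylGroup} :
    BruhatStep b x y ↔
      ∃ i, b.IsPos i ∧ b.IsPos (x • i) ∧ y = x * RootPairing.weylGroup.ofIdx P i := by
  constructor
  · rintro ⟨t, ⟨w, s, rfl⟩, rfl, hlt⟩
    have h : ∃ i, b.IsPos i ∧ w * simple b s * w⁻¹ = RootPairing.weylGroup.ofIdx P i := by
      have h1 : w * simple b s * w⁻¹ = RootPairing.weylGroup.ofIdx P (w • (s : ι)) := by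
        rw [simple, mul_ofIdx, mul_inv_cancel_right]
      by_cases h2 : b.IsPos (w • (s : ι))
      · exact ⟨_, h2, h1⟩
      · exact ⟨opp P (w • (s : ι)), (isPos_opp b _).2 h2, by rw [ofIdx_opp, h1]⟩
    obtain ⟨i, hi, h⟩ := h
    rw [h] at hlt ⊢
    exact ⟨i, hi, (length_lt_mul_ofIdx_iff b hi).1 hlt, rfl⟩
  · rintro ⟨i, hi, hx, rfl⟩
    exact ⟨_, isReflection_ofIdx b i, rfl, length_lt_mul_ofIdx b hi hx⟩

theorem bruhatLE_refl (x : P.weylGroup) : BruhatLE b x x := Relation.ReflTransGen.refl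

variable {b} in
theorem BruhatLE.trans {x y z : P.weylGroup} (h : BruhatLE b x y) (h' : BruhatLE b y z) :
    BruhatLE b x z := Relation.ReflTransGen.trans h h'

variable {b} in
theorem BruhatStep.le {x y : P.weylGroup} (h : BruhatStep b x y) : BruhatLE b x y :=
  Relation.ReflTransGen.single h

variable {b} in
theorem BruhatLE.eq_or_lt {x y : P.weylGroup} (h : BruhatLE b x y) :
    x = y ∨ length b x < length b y := by
  induction h with
  | refl => exact Or.inl rfl
  | tail _ h ih =>
    obtain ⟨-, -, -, hlt⟩ := h
    rcases ih with rfl | ih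
    · exact Or.inr hlt
    · exact Or.inr (ih.trans hlt)

theorem bruhatLE_mul_simple {x : P.weylGroup} {s : b.support} (h : b.IsPos (x • (s : ι))) :
    BruhatLE b x (x * simple b s) :=
  BruhatStep.le ((bruhatStep_iff b).2 ⟨s, isPos_simple b s, h, rfl⟩)

theorem bruhatStep_inv {x y : P.weylGroup} (h : BruhatStep b x y) : BruhatStep b x⁻¹ y⁻¹ := by
  obtain ⟨t, ht, rfl, hlt⟩ := h
  refine ⟨x * t⁻¹ * x⁻¹, IsReflection.conj b ?_ x, by group, by rwa [length_inv, length_inv]⟩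
  obtain ⟨w, s, rfl⟩ := ht
  exact ⟨w, s, by rw [mul_inv_rev, mul_inv_rev, simple_inv, inv_inv, mul_assoc]⟩

variable {b} in
theorem BruhatLE.inv {x y : P.weylGroup} (h : BruhatLE b x y) : BruhatLE b x⁻¹ y⁻¹ := by
  induction h with
  | refl => exact bruhatLE_refl b _
  | tail _ h ih => exact ih.trans (bruhatStep_inv b h).le

theorem bruhatLE_inv_iff {x y : P.weylGroup} : BruhatLE b x⁻¹ y⁻¹ ↔ BruhatLE b x y :=
  ⟨fun h => by simpa using h.inv, BruhatLE.inv⟩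

theorem bruhatLE_simple_mul {x : P.weylGroup} {s : b.support} (h : b.IsPos (x⁻¹ • (s : ι))) :
    BruhatLE b x (simple b s * x) := by
  rw [← bruhatLE_inv_iff, mul_inv_rev, simple_inv]
  exact bruhatLE_mul_simple b h

/-- Left multiplication by s can reverse a step only if the root x α is the simple root of s, and
then that step is itself multiplication by s. This is the source of the lifting properties below. -/
theorem BruhatStep.simple_mul {x y : P.weylGroup} (h : BruhatStep b x y) (s : b.support) :
    BruhatLE b (simple b s * x) (simple b s * y) ∨ simple b s * x = y := by
  obtain ⟨i, hi, hx, rfl⟩ := (bruhatStep_iff b).1 h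
  by_cases hs : b.IsPos ((simple b s * x) • i)
  · left
    rw [← mul_assoc]
    exact BruhatStep.le ((bruhatStep_iff b).2 ⟨i, hi, hs, rfl⟩)
  · right
    rw [mul_smul] at hs
    have : x • i = s := by
      by_contra hne
      exact hs (isPos_simple_smul b s hx hne)
    rw [mul_ofIdx, this]
    rfl

theorem simple_mul_bruhatLE {x v : P.weylGroup} (h : BruhatLE b x v) (s : b.support) :
    BruhatLE b (simple b s * x) v ∨ BruhatLE b (simple b s * x) (simple b s * v) := by
  induction h using Relation.ReflTransGen.head_induction_on with
  | refl => exact Or.inr (bruhatLE_refl b _)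
  | head h h' ih =>
    rcases BruhatStep.simple_mul b h s with h1 | h1
    · exact ih.imp h1.trans h1.trans
    · rw [h1]; exact Or.inl h'

theorem bruhatLE_simple_mul_or {x v : P.weylGroup} (h : BruhatLE b x v) (s : b.support) :
    BruhatLE b x (simple b s * v) ∨ BruhatLE b (simple b s * x) (simple b s * v) := by
  induction h with
  | refl => exact Or.inr (bruhatLE_refl b _)
  | tail h' h ih =>
    rcases BruhatStep.simple_mul b h s with h1 | h1
    · exact ih.imp (fun h2 => h2.trans h1) (fun h2 => h2.trans h1)
    · left
      rw [← h1, simple_mul_simple_mul]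
      exact h'

/-- Multiply by the letters of a reduced word of u: each raises the length of the upper element, so
lifting applies. No length additivity is needed for u y. -/
theorem mul_bruhatLE_mul {u v : P.weylGroup} (huv : length b (u * v) = length b u + length b v) :
    BruhatLE b v (u * v) ∧ ∀ y, BruhatLE b y v → BruhatLE b (u * y) (u * v) := by
  obtain ⟨l, rfl, hl⟩ := exists_reduced b u
  rw [← hl] at huv
  clear hl
  induction l with
  | nil => simp [bruhatLE_refl]
  | cons s l ih =>
    rw [wordProd_cons, mul_assoc, List.length_cons] at huv
    have h1 := length_mul_le b (wordProd b l) v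
    have h2 := length_wordProd_le b l
    have h3 : b.IsPos ((wordProd b l * v)⁻¹ • (s : ι)) := by
      by_contra hn
      have := length_simple_mul_neg b hn
      omega
    have h4 := length_simple_mul b h3
    obtain ⟨h5, h6⟩ := ih (by omega)
    rw [wordProd_cons, mul_assoc]
    refine ⟨h5.trans (bruhatLE_simple_mul b h3), fun y hy => ?_⟩
    rw [mul_assoc]
    exact (simple_mul_bruhatLE b (h6 y hy) s).elim
      (fun h => h.trans (bruhatLE_simple_mul b h3)) id

theorem bruhatLE_of_negSet_subset {x y : P.weylGroup} (h : negSet b x ⊆ negSet b y) :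
    BruhatLE b x y := by
  generalize hn : length b y - length b x = n
  induction n generalizing x with
  | zero => rw [negSet_subset_antisymm b h (by omega)]; exact bruhatLE_refl b _
  | succ n ih =>
    by_cases hxy : x = y
    · rw [hxy]; exact bruhatLE_refl b _
    obtain ⟨s, hs, hs'⟩ := exists_weak_step b h hxy
    have := length_mul_simple b hs
    exact (bruhatLE_mul_simple b hs).trans (ih hs' (by omega))

/-- By strong exchange, going down one step deletes a letter from a word in J. -/
theorem mem_parabolic_of_bruhatLE {J : Set b.support} {x v : P.weylGroup}
    (hv : v ∈ parabolic b J) (h : BruhatLE b x v) : x ∈ parabolic b J := by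
  induction h using Relation.ReflTransGen.head_induction_on with
  | refl => exact hv
  | head h _ ih =>
    obtain ⟨i, hi, hx, rfl⟩ := (bruhatStep_iff b).1 h
    obtain ⟨l, hl, hw⟩ := (mem_parabolic_iff b).1 ih
    obtain ⟨l', h1, -, h2⟩ := strong_exchange b (l := l) hi (by
      rw [hw, mul_smul, ofIdx_smul_self, smul_opp, isPos_opp, not_not]; exact hx)
    rw [hw, mul_assoc, ofIdx_mul_self, mul_one] at h2
    exact (mem_parabolic_iff b).2 ⟨l', fun s hs => hl s (h1.subset hs), h2⟩

theorem parabolic_mul_bruhatLE {J : Set b.support} {a u y : P.weylGroup}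
    (hu : u ∈ parabolic b J) (h : BruhatLE b a u) (hy : y ∈ minReps b J) :
    BruhatLE b (a * y) (u * y) := by
  suffices BruhatLE b (a * y) (u * y) ∧ a ∈ parabolic b J from this.1
  induction h using Relation.ReflTransGen.head_induction_on with
  | refl => exact ⟨bruhatLE_refl b _, hu⟩
  | @head a a' h h' ih =>
    have ha := mem_parabolic_of_bruhatLE b ih.2 (BruhatStep.le h)
    obtain ⟨t, ht, rfl, hlt⟩ := h
    refine ⟨BruhatLE.trans (BruhatStep.le ⟨y⁻¹ * t * y⁻¹⁻¹, ht.conj b _, by group, ?_⟩) ih.1, ha⟩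
    rw [length_mul_of_mem_minReps b ha hy, length_mul_of_mem_minReps b ih.2 hy]
    omega

theorem mul_bruhatLE_mul_of_le {J : Set b.support} {a u y v : P.weylGroup}
    (hu : u ∈ parabolic b J) (hau : BruhatLE b a u) (hy : y ∈ minReps b J)
    (hv : v ∈ minReps b J) (hyv : BruhatLE b y v) : BruhatLE b (a * y) (u * v) :=
  (parabolic_mul_bruhatLE b hu hau hy).trans
    ((mul_bruhatLE_mul b (length_mul_of_mem_minReps b hu hv)).2 y hyv)

theorem left_factor_bruhatLE {J : Set b.support} {a y : P.weylGroup}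
    (ha : a ∈ parabolic b J) (hy : y ∈ minReps b J) : BruhatLE b a (a * y) :=
  bruhatLE_of_negSet_subset b (by rw [negSet_eq_of_mul b ha hy]; exact Set.sep_subset _ _)

/-- Stripping the letters of u from the upper bound costs at most a left factor c in W_J, and y is
below every element of its coset W_J y. -/
theorem right_factor_bruhatLE {J : Set b.support} {a y u v : P.weylGroup}
    (ha : a ∈ parabolic b J) (hy : y ∈ minReps b J) (hu : u ∈ parabolic b J)
    (h : BruhatLE b (a * y) (u * v)) : BruhatLE b y v := by
  obtain ⟨c, hc, hle⟩ : ∃ c ∈ parabolic b J, BruhatLE b (c * (a * y)) v := by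
    generalize a * y = x at h
    obtain ⟨l, hl, rfl⟩ := (mem_parabolic_iff b).1 hu
    clear hu
    induction l generalizing x with
    | nil => exact ⟨1, one_mem _, by simpa using h⟩
    | cons s l ih =>
      have hl' : ∀ t ∈ l, t ∈ J := fun t ht => hl t (List.mem_cons_of_mem _ ht)
      have hs : simple b s ∈ parabolic b J := simple_mem_parabolic b (hl s (by simp))
      have h1 := bruhatLE_simple_mul_or b h s
      rw [wordProd_cons, mul_assoc, simple_mul_simple_mul] at h1
      rcases h1 with h1 | h1
      · exact ih x hl' h1
      · obtain ⟨c, hc, hc'⟩ := ih _ hl' h1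
        exact ⟨c * simple b s, mul_mem hc hs, by rwa [mul_assoc]⟩
  refine BruhatLE.trans ?_ hle
  rw [← mul_assoc]
  exact (mul_bruhatLE_mul b (length_mul_of_mem_minReps b (mul_mem hc ha) hy)).1

/-! ### Factorization of the Poincaré polynomial -/

/-- The generating function of the elements of `ᴶW` below `v`. -/
def quotientPoly (J : Set b.support) (v : P.weylGroup) : ℤ[X] :=
  ∑ y ∈ (Set.toFinite {y | BruhatLE b y v ∧ y ∈ minReps b J}).toFinset, X ^ length b y

/-- Parabolic factorization is the bijection: maximality of u bounds the left factor of any x ≤ w,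
and `right_factor_bruhatLE` bounds the right one. -/
theorem poincarePoly_eq_mul {J : Set b.support} {w u v : P.weylGroup}
    (h : IsMaxParabolicDecomposition b J w u v) :
    poincarePoly b w = poincarePoly b u * quotientPoly b J v := by
  obtain ⟨rfl, hu, hv, -, hmax⟩ := h
  rw [poincarePoly, poincarePoly, quotientPoly, Finset.sum_mul_sum, ← Finset.sum_product']
  symm
  refine Finset.sum_bij (fun p _ => p.1 * p.2) ?_ ?_ ?_ ?_
  · rintro ⟨a, y⟩ hp
    simp only [Finset.mem_product, Set.Finite.mem_toFinset, mem_ofPred_eq] at hp ⊢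
    exact mul_bruhatLE_mul_of_le b hu hp.1 hp.2.2 hv hp.2.1
  · rintro ⟨a, y⟩ hp ⟨a', y'⟩ hp' heq
    simp only [Finset.mem_product, Set.Finite.mem_toFinset, mem_ofPred_eq] at hp hp' heq
    obtain ⟨rfl, rfl⟩ := parabolic_decomposition_unique b
      (mem_parabolic_of_bruhatLE b hu hp.1) hp.2.2 (mem_parabolic_of_bruhatLE b hu hp'.1)
      hp'.2.2 heq
    rfl
  · intro x hx
    simp only [Set.Finite.mem_toFinset, mem_ofPred_eq] at hx
    obtain ⟨a, ha, y, hy, rfl⟩ := exists_parabolic_decomposition b J x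
    refine ⟨(a, y), ?_, rfl⟩
    simp only [Finset.mem_product, Set.Finite.mem_toFinset, mem_ofPred_eq]
    exact ⟨hmax a ha ((left_factor_bruhatLE b ha hy).trans hx),
      right_factor_bruhatLE b ha hy hu hx, hy⟩
  · rintro ⟨a, y⟩ hp
    simp only [Finset.mem_product, Set.Finite.mem_toFinset, mem_ofPred_eq] at hp
    rw [length_mul_of_mem_minReps b (mem_parabolic_of_bruhatLE b hu hp.1) hp.2.2, pow_add]

theorem poincarePoly_inv (w : P.weylGroup) : poincarePoly b w⁻¹ = poincarePoly b w := by
  refine Finset.sum_bij (fun x _ => x⁻¹) ?_ ?_ ?_ ?_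
  · intro x hx
    simp only [Set.Finite.mem_toFinset, mem_ofPred_eq] at hx ⊢
    simpa using hx.inv
  · exact fun x _ y _ h => inv_injective h
  · intro x hx
    simp only [Set.Finite.mem_toFinset, mem_ofPred_eq] at hx ⊢
    exact ⟨x⁻¹, hx.inv, inv_inv x⟩
  · intro x _
    rw [length_inv]

theorem simple_bruhatLE_of_mem_letters {v : P.weylGroup} {s : b.support} (hs : s ∈ letters b v) :
    BruhatLE b (simple b s) v := by
  obtain ⟨l, rfl, hl, hmem⟩ := hs
  obtain ⟨l₁, l₂, rfl⟩ := List.append_of_mem hmem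
  rw [wordProd_append, wordProd_cons] at hl ⊢
  have h1 := length_mul_le b (wordProd b l₁) (simple b s * wordProd b l₂)
  have h2 := length_mul_le b (simple b s) (wordProd b l₂)
  have h3 := length_wordProd_le b l₁
  have h4 := length_wordProd_le b l₂
  have h5 := length_simple_le b s
  simp only [List.length_append, List.length_cons] at hl
  have h6 := (mul_bruhatLE_mul b (u := wordProd b l₁) (v := simple b s * wordProd b l₂)
    (by omega)).1
  have h7 := (mul_bruhatLE_mul b (u := (wordProd b l₂)⁻¹) (v := (simple b s)⁻¹) (by
    rw [← mul_inv_rev, length_inv, length_inv, length_inv]; omega)).1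
  rw [← mul_inv_rev, bruhatLE_inv_iff] at h7
  exact h7.trans h6

/-- In a BP-decomposition `u v`, the letters of `v` in `J` are right descents of `u`. -/
theorem not_isPos_of_mem_letters {J : Set b.support} {w u v : P.weylGroup}
    (h : IsMaxParabolicDecomposition b J w u v) {s : b.support} (hs : s ∈ letters b v)
    (hJ : s ∈ J) : ¬ b.IsPos (u • (s : ι)) := by
  obtain ⟨rfl, hu, hv, -, hmax⟩ := h
  intro hpos
  -- If us were longer than u, it would be an element of W_J below w that is longer than the maximum
  -- u.
  have h1 := (mul_bruhatLE_mul b (length_mul_of_mem_minReps b hu hv)).2 _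
    (simple_bruhatLE_of_mem_letters b hs)
  have h2 := (hmax _ (mul_mem hu (simple_mem_parabolic b hJ)) h1).eq_or_lt
  have h3 := length_mul_simple b hpos
  rcases h2 with h2 | h2
  · rw [h2] at h3; omega
  · omega

theorem mem_parabolic_letters (v : P.weylGroup) : v ∈ parabolic b (letters b v) := by
  obtain ⟨l, h1, h2⟩ := exists_reduced b v
  exact (mem_parabolic_iff b).2 ⟨l, fun s hs => ⟨l, h1, h2, hs⟩, h1⟩

open HyperplaneArrangement

/-! ### Chambers and the Weyl group -/

/-- A point in the interior of the Weyl chamber of `x`. -/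
def chamberPoint (x : P.weylGroup) : N :=
  P.toLinearMap.flip.toPerfPair.symm (ht b ∘ₗ actLin x⁻¹)

theorem root'_chamberPoint (x : P.weylGroup) (i : ι) :
    P.root' i (chamberPoint b x) = ht b (P.root (x⁻¹ • i)) := by
  rw [chamberPoint, RootPairing.root', LinearMap.apply_toPerfPair_flip, LinearMap.comp_apply,
    actLin_root]

theorem root'_chamberPoint_pos {x : P.weylGroup} {i : ι} :
    0 < P.root' i (chamberPoint b x) ↔ b.IsPos (x⁻¹ • i) := by
  rw [root'_chamberPoint, isPos_iff_ht]

theorem root'_chamberPoint_neg {x : P.weylGroup} {i : ι} :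
    P.root' i (chamberPoint b x) < 0 ↔ ¬ b.IsPos (x⁻¹ • i) := by
  rw [root'_chamberPoint, isPos_iff_ht', not_le]

theorem root'_eq_sum (i : ι) (p : N) :
    P.root' i p = ∑ j : b.support, coeff b (P.root i) j * P.root' (j : ι) p := by
  conv_lhs => rw [RootPairing.root', ← sum_coeff b (P.root i)]
  simp [RootPairing.root']

theorem root'_coreflection (s i : ι) (p : N) :
    P.root' i (P.coreflection s p) = P.root' (P.reflectionPerm s i) p := by
  simp [RootPairing.root', P.coreflection_apply, P.reflection_apply, mul_comm]

/-- Every point lies in a closed Weyl chamber. -/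
theorem exists_closed_weylChamber (p : N) :
    ∃ g : P.weylGroup, ∀ i, b.IsPos (g⁻¹ • i) → 0 ≤ P.root' i p := by
  generalize hn : {i | b.IsPos i ∧ P.root' i p < 0}.ncard = n
  induction n using Nat.strong_induction_on generalizing p with
  | _ n ih =>
  by_cases h : ∀ s : b.support, 0 ≤ P.root' (s : ι) p
  · refine ⟨1, fun i hi => ?_⟩
    rw [inv_one, one_smul] at hi
    rw [root'_eq_sum b]
    exact Finset.sum_nonneg fun j _ => mul_nonneg (coeff_nonneg b hi j) (h j)
  · push Not at h
    obtain ⟨s, hs⟩ := h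
    have hopp : P.root' (opp P s) p = -P.root' (s : ι) p := by
      simp [RootPairing.root', root_opp]
    have hlt : {i | b.IsPos i ∧ P.root' i (P.coreflection s p) < 0}.ncard < n := by
      rw [← hn]
      -- The reflection s embeds the roots negative at the reflected point into those negative at p,
      -- and misses the simple root of s.
      have hsub : (fun i => simple b s • i) '' {i | b.IsPos i ∧ P.root' i (P.coreflection s p) < 0}
          ⊆ {i | b.IsPos i ∧ P.root' i p < 0} \ {(s : ι)} := by
        rintro _ ⟨i, ⟨h1, h2⟩, rfl⟩
        rw [root'_coreflection] at h2
        have hne : i ≠ s := by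
          rintro rfl
          change P.root' (opp P s) p < 0 at h2
          linarith
        refine ⟨⟨isPos_simple_smul b s h1 hne, h2⟩, fun h3 => ?_⟩
        change simple b s • i = (s : ι) at h3
        rw [← simple_smul_simple_smul b s i, h3] at h1
        exact not_isPos_simple_smul_self b s h1
      rw [← Set.ncard_image_of_injective _ (MulAction.injective (simple b s))]
      refine lt_of_le_of_lt (Set.ncard_le_ncard hsub) ?_
      exact Set.ncard_sdiff_singleton_lt_of_mem ⟨isPos_simple b s, hs⟩
    obtain ⟨g, hg⟩ := ih _ hlt _ rfl
    refine ⟨simple b s * g, fun i hi => ?_⟩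
    rw [mul_inv_rev, simple_inv, mul_smul] at hi
    have := hg _ hi
    rwa [root'_coreflection, ← simple_smul, simple_smul_simple_smul] at this

/-- Equal kernels force proportional roots, which reducedness forbids for distinct positive roots.
The factor 1/2 below comes from ⟨α, α^∨⟩ = 2. Thus counting hyperplanes is counting roots. -/
theorem ker_root'_injOn : Set.InjOn (fun i => LinearMap.ker (P.root' i)) {i | b.IsPos i} := by
  intro i hi j hj h
  by_contra hne
  have hlin := RootPairing.IsReduced.linearIndependent P hne fun h' => by
    have h1 := (isPos_iff_ht b i).1 hi
    have h2 := (isPos_iff_ht b j).1 hj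
    rw [h', map_neg] at h1
    linarith
  have hj2 : ∀ y : N, P.root' j y = P.root' i y / 2 * P.root' j (P.coroot i) := fun y => by
    have h1 : y - (P.root' i y / 2) • P.coroot i ∈ LinearMap.ker (P.root' i) := by
      simp
    have h2 : y - (P.root' i y / 2) • P.coroot i ∈ LinearMap.ker (P.root' j) := by
      rw [← show LinearMap.ker (P.root' i) = LinearMap.ker (P.root' j) from h]; exact h1
    rw [LinearMap.mem_ker, map_sub, map_smul, sub_eq_zero, smul_eq_mul] at h2
    exact h2
  have hj3 : (P.pairing j i / 2) • P.root i + (-1 : ℝ) • P.root j = 0 := by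
    refine P.toPerfPair.injective (LinearMap.ext fun y => ?_)
    have h1 := hj2 y
    simp only [map_add, map_smul, LinearMap.add_apply, LinearMap.smul_apply,
      LinearMap.toPerfPair_apply, smul_eq_mul, map_zero, LinearMap.zero_apply]
    rw [P.root'_coroot_eq_pairing] at h1
    change P.pairing j i / 2 * P.root' i y + -1 * P.root' j y = 0
    linarith
  have := (LinearIndependent.pair_iff.1 hlin _ _ hj3).2
  norm_num at this

/-! ### Chambers of the inversion arrangement as sign patterns -/

/-- The set of roots in `A` that are negative on the Weyl chamber of `x`. -/
def signSet (A : Set ι) (x : P.weylGroup) : Set ι := {i ∈ A | ¬ b.IsPos (x⁻¹ • i)}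

/-- The generating function of the sign patterns of Weyl chambers on `A`. -/
def signPoly (A : Set ι) : ℤ[X] :=
  ∑ T ∈ (Set.toFinite (Set.range (signSet b A))).toFinset, X ^ T.ncard

theorem chamberOf_chamberPoint (w x : P.weylGroup) :
    chamberOf (inversionArrangement b w) (chamberPoint b x) =
      {y | ∀ i ∈ inversionSet b w, (i ∈ signSet b (inversionSet b w) x → P.root' i y < 0) ∧
        (i ∉ signSet b (inversionSet b w) x → 0 < P.root' i y)} := by
  ext y
  have h1 : y ∈ chamberOf (inversionArrangement b w) (chamberPoint b x) ↔
      ∀ i ∈ inversionSet b w, 0 < P.root' i (chamberPoint b x) * P.root' i y := by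
    constructor
    · exact fun h i hi => (sSameSide_ker_iff _ _ _).1 (h _ ⟨i, hi, rfl⟩)
    · rintro h _ ⟨i, hi, rfl⟩
      exact (sSameSide_ker_iff _ _ _).2 (h i hi)
  rw [h1, mem_ofPred_eq]
  refine forall₂_congr fun i hi => ?_
  by_cases hx : b.IsPos (x⁻¹ • i)
  · have hT : i ∉ signSet b (inversionSet b w) x := fun h => h.2 hx
    rw [mul_pos_iff_of_pos_left ((root'_chamberPoint_pos b).2 hx)]
    simp [hT]
  · have hT : i ∈ signSet b (inversionSet b w) x := ⟨hi, hx⟩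
    have h2 := (root'_chamberPoint_neg b).2 hx
    simp only [hT, true_implies, not_true_eq_false, false_implies, and_true]
    exact ⟨fun h => neg_of_mul_pos_right h h2.le, fun h => mul_pos_of_neg_of_neg h2 h⟩

theorem chamberPoint_mem (w x : P.weylGroup) :
    chamberPoint b x ∈ chamberOf (inversionArrangement b w) (chamberPoint b x) := by
  rw [chamberOf_chamberPoint]
  exact fun i hi => ⟨fun h => (root'_chamberPoint_neg b).2 h.2,
    fun h => (root'_chamberPoint_pos b).2 (by_contra fun h' => h ⟨hi, h'⟩)⟩

theorem chamberOf_mem_chambers (w x : P.weylGroup) :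
    chamberOf (inversionArrangement b w) (chamberPoint b x) ∈
      chambers (inversionArrangement b w) := by
  refine ⟨_, ?_, rfl⟩
  rintro _ ⟨i, -, rfl⟩ h
  rw [LinearMap.mem_ker] at h
  by_cases hx : b.IsPos (x⁻¹ • i)
  · exact ((root'_chamberPoint_pos b).2 hx).ne' h
  · exact ((root'_chamberPoint_neg b).2 hx).ne h

/-- A point of the region lies in some closed Weyl chamber; as it avoids the hyperplanes of the
arrangement, its weak inequalities are strict there and fix the region. -/
theorem exists_eq_chamberOf_chamberPoint {w : P.weylGroup} {r : Set N}
    (hr : r ∈ chambers (inversionArrangement b w)) :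
    ∃ x, r = chamberOf (inversionArrangement b w) (chamberPoint b x) := by
  obtain ⟨p, hp, rfl⟩ := hr
  obtain ⟨g, hg⟩ := exists_closed_weylChamber b p
  refine ⟨g, ?_⟩
  have hsign : ∀ i ∈ inversionSet b w, 0 < P.root' i (chamberPoint b g) * P.root' i p := by
    intro i hi
    have h0 : P.root' i p ≠ 0 := hp _ ⟨i, hi, rfl⟩
    by_cases hx : b.IsPos (g⁻¹ • i)
    · exact mul_pos ((root'_chamberPoint_pos b).2 hx) (lt_of_le_of_ne (hg i hx) h0.symm)
    · have h1 := hg (opp P i) (by rwa [smul_opp, isPos_opp])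
      have h2 : P.root' (opp P i) p = -P.root' i p := by simp [RootPairing.root', root_opp]
      rw [h2] at h1
      exact mul_pos_of_neg_of_neg ((root'_chamberPoint_neg b).2 hx)
        (lt_of_le_of_ne (by linarith) h0)
  ext y
  constructor
  · rintro h _ ⟨i, hi, rfl⟩
    have h1 := (sSameSide_ker_iff _ _ _).1 (h _ ⟨i, hi, rfl⟩)
    have h2 := hsign i hi
    rw [sSameSide_ker_iff]
    rcases mul_pos_iff.1 h1 with ⟨h3, h4⟩ | ⟨h3, h4⟩
    · exact mul_pos ((mul_pos_iff_of_pos_right h3).1 h2) h4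
    · exact mul_pos_of_neg_of_neg (neg_of_mul_pos_left h2 h3.le) h4
  · rintro h _ ⟨i, hi, rfl⟩
    have h1 := (sSameSide_ker_iff _ _ _).1 (h _ ⟨i, hi, rfl⟩)
    have h2 := hsign i hi
    rw [sSameSide_ker_iff]
    rcases mul_pos_iff.1 h1 with ⟨h3, h4⟩ | ⟨h3, h4⟩
    · exact mul_pos ((mul_pos_iff_of_pos_left h3).1 h2) h4
    · exact mul_pos_of_neg_of_neg (neg_of_mul_pos_right h2 h3.le) h4

theorem isPos_of_mem_inversionSet {w : P.weylGroup} {i : ι} (h : i ∈ inversionSet b w) :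
    b.IsPos i := h.1

theorem separation_chamberPoint (w x : P.weylGroup) :
    separation (inversionArrangement b w) (fundamentalChamber b w)
      (chamberOf (inversionArrangement b w) (chamberPoint b x)) =
    (signSet b (inversionSet b w) x).ncard := by
  have h1 : {H ∈ inversionArrangement b w | ∀ y ∈ fundamentalChamber b w,
      ∀ z ∈ chamberOf (inversionArrangement b w) (chamberPoint b x),
        H.toAffineSubspace.SOppSide y z} =
      (fun i => LinearMap.ker (P.root' i)) '' signSet b (inversionSet b w) x := by
    have hfund : chamberPoint b 1 ∈ fundamentalChamber b w := fun i hi =>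
      (root'_chamberPoint_pos b).2 (by simpa using hi.1)
    ext H
    constructor
    · rintro ⟨⟨i, hi, rfl⟩, h⟩
      refine ⟨i, ⟨hi, ?_⟩, rfl⟩
      have h2 := (sOppSide_ker_iff _ _ _).1 (h _ hfund _ (chamberPoint_mem b w x))
      have h3 := hfund i hi
      rw [← root'_chamberPoint_neg]
      exact (pos_iff_neg_of_mul_neg h2).1 h3
    · rintro ⟨i, hi, rfl⟩
      refine ⟨⟨i, hi.1, rfl⟩, fun y hy z hz => ?_⟩
      rw [chamberOf_chamberPoint] at hz
      exact (sOppSide_ker_iff _ _ _).2 (mul_neg_of_pos_of_neg (hy i hi.1) ((hz i hi.1).1 hi))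
  rw [separation, h1]
  exact Set.InjOn.ncard_image
    ((ker_root'_injOn b).mono fun i hi => isPos_of_mem_inversionSet b hi.1)

theorem distancePoly_eq_signPoly (w : P.weylGroup) :
    distancePoly b w = signPoly b (inversionSet b w) := by
  symm
  refine Finset.sum_bij (fun T _ => {y | ∀ i ∈ inversionSet b w, (i ∈ T → P.root' i y < 0) ∧
        (i ∉ T → 0 < P.root' i y)}) ?_ ?_ ?_ ?_
  · intro T hT
    rw [Set.Finite.mem_toFinset] at hT ⊢
    obtain ⟨x, rfl⟩ := hT
    rw [← chamberOf_chamberPoint]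
    exact chamberOf_mem_chambers b w x
  · have key : ∀ x x', chamberOf (inversionArrangement b w) (chamberPoint b x) =
        chamberOf (inversionArrangement b w) (chamberPoint b x') →
        signSet b (inversionSet b w) x ⊆ signSet b (inversionSet b w) x' := by
      intro x x' h i hi
      by_contra hi'
      have h1 := chamberPoint_mem b w x
      rw [h, chamberOf_chamberPoint] at h1
      exact lt_asymm ((h1 i hi.1).2 hi') ((root'_chamberPoint_neg b).2 hi.2)
    intro T hT T' hT' h
    rw [Set.Finite.mem_toFinset] at hT hT'
    obtain ⟨x, rfl⟩ := hT
    obtain ⟨x', rfl⟩ := hT'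
    rw [← chamberOf_chamberPoint, ← chamberOf_chamberPoint] at h
    exact (key x x' h).antisymm (key x' x h.symm)
  · intro r hr
    rw [Set.Finite.mem_toFinset] at hr
    obtain ⟨x, rfl⟩ := exists_eq_chamberOf_chamberPoint b hr
    exact ⟨signSet b (inversionSet b w) x, by simp, (chamberOf_chamberPoint b w x).symm⟩
  · intro T hT
    rw [Set.Finite.mem_toFinset] at hT
    obtain ⟨x, rfl⟩ := hT
    rw [← chamberOf_chamberPoint, separation_chamberPoint]

/-- The map α ↦ -wα carries Δ_w onto Δ_{w⁻¹}, and x ↦ w x w₀ matches the patterns, with w₀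
compensating for the minus sign. -/
theorem distancePoly_inv (w : P.weylGroup) : distancePoly b w⁻¹ = distancePoly b w := by
  obtain ⟨w₀, -, hN⟩ := exists_longest b (Set.univ : Set b.support)
  have key : ∀ v x : P.weylGroup, (fun i => opp P (v • i)) '' signSet b (inversionSet b v) x =
      signSet b (inversionSet b v⁻¹) (v * x * w₀) := by
    intro v x
    have hpos : ∀ i, ¬ b.IsPos ((v * x * w₀)⁻¹ • i) ↔ b.IsPos ((v * x)⁻¹ • i) := fun i => by
      rw [mul_inv_rev, mul_smul, isPos_inv_smul_of_longest b hN (supp_univ _), not_not]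
    ext i
    simp only [signSet, inversionSet_eq, negSet, inv_inv, mem_image, mem_ofPred_eq, hpos]
    constructor
    · rintro ⟨i, ⟨⟨h1, h2⟩, h3⟩, rfl⟩
      refine ⟨⟨(isPos_opp b _).2 h2, ?_⟩, ?_⟩
      · rwa [smul_opp, inv_smul_smul, isPos_opp, not_not]
      · rwa [smul_opp, mul_inv_rev, mul_smul, inv_smul_smul, isPos_opp]
    · rintro ⟨⟨h1, h2⟩, h3⟩
      refine ⟨v⁻¹ • opp P i, ⟨⟨?_, ?_⟩, ?_⟩, ?_⟩
      · rwa [smul_opp, isPos_opp]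
      · rwa [smul_inv_smul, isPos_opp, not_not]
      · rw [smul_opp, smul_opp, ← mul_smul, ← mul_inv_rev, isPos_opp, not_not]
        exact h3
      · rw [smul_inv_smul, opp_opp]
  have hinj : Function.Injective fun i : ι => opp P (w • i) := fun i j h => by
    have := congrArg (opp P) h
    simpa using this
  rw [distancePoly_eq_signPoly, distancePoly_eq_signPoly]
  symm
  refine Finset.sum_bij (fun T _ => (fun i => opp P (w • i)) '' T) ?_ ?_ ?_ ?_
  · intro T hT
    rw [Set.Finite.mem_toFinset] at hT ⊢
    obtain ⟨x, rfl⟩ := hT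
    exact ⟨_, (key w x).symm⟩
  · exact fun T _ T' _ h => hinj.image_injective h
  · intro T hT
    rw [Set.Finite.mem_toFinset] at hT
    obtain ⟨x, rfl⟩ := hT
    refine ⟨signSet b (inversionSet b w) (w⁻¹ * x * w₀⁻¹), by simp, ?_⟩
    rw [key]
    congr 1
    group
  · intro T _
    rw [Set.ncard_image_of_injective _ hinj]

/-! ### The embedded quotient -/

/-- The positive roots of `Φ_K` that do not belong to `Φ_J`. -/
def quotientRoots (K J : Set b.support) : Set ι := {i | b.IsPos i ∧ Supp b K i ∧ ¬ Supp b J i}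

/-- The embedded quotient becomes a lower interval of the weak order, with top the element of
`exists_top_embeddedQuotient`. -/
theorem mem_embeddedQuotient_iff {K J : Set b.support} {y : P.weylGroup} :
    y ∈ embeddedQuotient b K J ↔ negSet b y ⊆ quotientRoots b K J := by
  constructor
  · rintro ⟨h1, h2⟩ i hi
    have hK := supp_of_mem_negSet h1 hi
    exact ⟨hi.1, hK, fun hJ => hi.2 (isPos_of_mem_minReps b h2 hi.1 (hK.inter hJ))⟩
  · intro h
    refine ⟨mem_parabolic_of_negSet b fun i hi => (h hi).2.1, (mem_minReps_iff b).2 ?_⟩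
    intro j hj
    by_contra hn
    exact (h ⟨isPos_simple b j, hn⟩).2.2 (supp_simple hj.2)

theorem mem_minReps_of_mem_embeddedQuotient {K J : Set b.support} {y : P.weylGroup}
    (hy : y ∈ embeddedQuotient b K J) : y ∈ minReps b J := by
  rw [mem_embeddedQuotient_iff] at hy
  refine (mem_minReps_iff b).2 fun j hj => ?_
  by_contra hn
  exact (hy ⟨isPos_simple b j, hn⟩).2.2 (supp_simple hj)

theorem mem_embeddedQuotient_of_mem_minReps {K J : Set b.support} {y : P.weylGroup}
    (hK : y ∈ parabolic b K) (hJ : y ∈ minReps b J) : y ∈ embeddedQuotient b K J :=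
  ⟨hK, (mem_minReps_iff b).2 fun j hj => (mem_minReps_iff b).1 hJ j hj.2⟩

theorem one_mem_embeddedQuotient (K J : Set b.support) : 1 ∈ embeddedQuotient b K J := by
  rw [mem_embeddedQuotient_iff, negSet_one]
  exact Set.empty_subset _

theorem exists_top_embeddedQuotient (K J : Set b.support) :
    ∃ x : P.weylGroup, negSet b x = quotientRoots b K J := by
  obtain ⟨w, hw, hN⟩ := exists_longest b (K ∩ J)
  obtain ⟨w', hw', hN'⟩ := exists_longest b K
  have hwK : w ∈ parabolic b K := parabolic_mono b Set.inter_subset_left hw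
  have hflip : ∀ i, Supp b (K ∩ J) i → (b.IsPos (w • i) ↔ ¬ b.IsPos i) := fun i hi => by
    have := isPos_inv_smul_of_longest b hN ((supp_smul hw).2 hi)
    rw [inv_smul_smul] at this
    tauto
  -- On Φ_{K∩J} the two longest elements cancel, so only roots of Φ_K outside Φ_J are negated.
  refine ⟨w⁻¹ * w', ?_⟩
  ext i
  simp only [negSet, quotientRoots, mem_ofPred_eq, mul_inv_rev, inv_inv, mul_smul]
  refine and_congr_right fun hi => ?_
  by_cases hK : Supp b K i
  · rw [isPos_inv_smul_of_longest b hN' ((supp_smul hwK).2 hK), not_not]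
    by_cases hJ : Supp b J i
    · rw [hflip i (hK.inter hJ)]
      simp [hi, hJ]
    · simp only [hK, hJ, not_false_eq_true, and_self, iff_true]
      exact isPos_smul_of_not_supp hw hi fun h => hJ (h.mono Set.inter_subset_right)
  · simp only [hK, false_and, iff_false, not_not]
    exact isPos_smul_of_not_supp (inv_mem hw') (isPos_smul_of_not_supp hwK hi hK)
      fun h => hK ((supp_smul hwK).1 h)

/-- Intervals of the weak order contain elements of all intermediate lengths. -/
theorem exists_length_eq {x z : P.weylGroup} (h : negSet b x ⊆ negSet b z) {n : ℕ}
    (h1 : length b x ≤ n) (h2 : n ≤ length b z) :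
    ∃ y, negSet b x ⊆ negSet b y ∧ negSet b y ⊆ negSet b z ∧ length b y = n := by
  induction n, h1 using Nat.le_induction with
  | base => exact ⟨x, le_rfl, h, rfl⟩
  | succ n hn ih =>
    obtain ⟨y, h3, h4, h5⟩ := ih (by omega)
    obtain ⟨s, hs, hs'⟩ := exists_weak_step b h4 (by rintro rfl; omega)
    refine ⟨_, h3.trans ?_, hs', by rw [length_mul_simple b hs, h5]⟩
    rw [negSet_mul_simple b hs]
    exact Set.subset_insert _ _

/-- The generating function of the traces of the sets of negated roots on `B`. -/
def tracePoly (K J : Set b.support) (B : Set ι) : ℤ[X] :=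
  ∑ G ∈ (Set.toFinite ((fun y => negSet b y ∩ B) '' embeddedQuotient b K J)).toFinset,
    X ^ G.ncard

theorem below_subset_embeddedQuotient {J : Set b.support} {v y : P.weylGroup}
    (h : BruhatLE b y v ∧ y ∈ minReps b J) : y ∈ embeddedQuotient b (letters b v) J :=
  mem_embeddedQuotient_of_mem_minReps b
    (mem_parabolic_of_bruhatLE b (mem_parabolic_letters b v) h.1) h.2

/-- By cardinality B must be all of N(v), so a trace on B is N(y) and determines y; and everything
in the quotient lies below v. -/
theorem tracePoly_eq_of_locallyLongest {J : Set b.support} {v : P.weylGroup} {B : Set ι}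
    (hv : ∀ x ∈ embeddedQuotient b (letters b v) J, length b x ≤ length b v)
    (hmem : v ∈ embeddedQuotient b (letters b v) J)
    (hB : B ⊆ quotientRoots b (letters b v) J) (hcard : B.ncard = length b v) :
    tracePoly b (letters b v) J B = quotientPoly b J v := by
  have hvN : negSet b v = quotientRoots b (letters b v) J := by
    obtain ⟨x, hx⟩ := exists_top_embeddedQuotient b (letters b v) J
    have h1 := hv x ((mem_embeddedQuotient_iff b).2 hx.le)
    refine Set.eq_of_subset_of_ncard_le ((mem_embeddedQuotient_iff b).1 hmem) ?_
    rwa [← hx, ncard_negSet, ncard_negSet]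
  have hBN : B = quotientRoots b (letters b v) J :=
    Set.eq_of_subset_of_ncard_le hB (by rw [← hvN, ncard_negSet, hcard])
  subst hBN
  have hinter : ∀ y ∈ embeddedQuotient b (letters b v) J,
      negSet b y ∩ quotientRoots b (letters b v) J = negSet b y := fun y hy =>
    Set.inter_eq_left.2 ((mem_embeddedQuotient_iff b).1 hy)
  symm
  refine Finset.sum_bij (fun y _ => negSet b y) ?_ ?_ ?_ ?_
  · intro y hy
    rw [Set.Finite.mem_toFinset] at hy ⊢
    exact ⟨y, below_subset_embeddedQuotient b hy, hinter y (below_subset_embeddedQuotient b hy)⟩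
  · exact fun y _ y' _ h => negSet_injective b h
  · intro G hG
    rw [Set.Finite.mem_toFinset] at hG
    obtain ⟨y, hy, rfl⟩ := hG
    refine ⟨y, ?_, (hinter y hy).symm⟩
    rw [Set.Finite.mem_toFinset]
    exact ⟨bruhatLE_of_negSet_subset b (by rw [hvN]; exact (mem_embeddedQuotient_iff b).1 hy),
      mem_minReps_of_mem_embeddedQuotient b hy⟩
  · intro y _
    rw [ncard_negSet]

theorem eq_of_length_eq_of_chain {K J : Set b.support}
    (hc : ∀ x ∈ embeddedQuotient b K J, ∀ y ∈ embeddedQuotient b K J,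
      BruhatLE b x y ∨ BruhatLE b y x) {x y : P.weylGroup} (hx : x ∈ embeddedQuotient b K J)
    (hy : y ∈ embeddedQuotient b K J) (h : length b x = length b y) : x = y := by
  rcases hc x hx y hy with h1 | h1
  · exact h1.eq_or_lt.resolve_right (by omega)
  · exact (h1.eq_or_lt.resolve_right (by omega)).symm

/-- A Bruhat chain is already a weak chain: between x and the top there is a quotient element of
length ℓ(y), and a chain has only one of each length. -/
theorem negSet_subset_of_chain {K J : Set b.support}
    (hc : ∀ x ∈ embeddedQuotient b K J, ∀ y ∈ embeddedQuotient b K J,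
      BruhatLE b x y ∨ BruhatLE b y x) {x y : P.weylGroup} (hx : x ∈ embeddedQuotient b K J)
    (hy : y ∈ embeddedQuotient b K J) (h : length b x ≤ length b y) :
    negSet b x ⊆ negSet b y := by
  obtain ⟨z, hz⟩ := exists_top_embeddedQuotient b K J
  have hyz : negSet b y ⊆ negSet b z := by rw [hz]; exact (mem_embeddedQuotient_iff b).1 hy
  have hxz : negSet b x ⊆ negSet b z := by rw [hz]; exact (mem_embeddedQuotient_iff b).1 hx
  have hlen : length b y ≤ length b z := by
    rw [← ncard_negSet, ← ncard_negSet]; exact Set.ncard_le_ncard hyz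
  obtain ⟨y', h1, h2, h3⟩ := exists_length_eq b hxz h hlen
  rw [hz] at h2
  rwa [← eq_of_length_eq_of_chain b hc ((mem_embeddedQuotient_iff b).2 h2) hy h3]

/-- Discrete intermediate values: take y of greatest length with trace at most n. One more weak step
adds a single root and overshoots n. -/
theorem exists_ncard_inter_eq (K J : Set b.support) {B : Set ι} (hB : B ⊆ quotientRoots b K J)
    {n : ℕ} (hn : n ≤ B.ncard) :
    ∃ y ∈ embeddedQuotient b K J, (negSet b y ∩ B).ncard = n := by
  obtain ⟨y, ⟨hy, hyn⟩, hmax⟩ := Set.exists_max_image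
    {y : P.weylGroup | y ∈ embeddedQuotient b K J ∧ (negSet b y ∩ B).ncard ≤ n}
    (fun y => length b y) (Set.toFinite _) ⟨1, one_mem_embeddedQuotient b K J, by simp⟩
  refine ⟨y, hy, le_antisymm hyn ?_⟩
  obtain ⟨z, hz⟩ := exists_top_embeddedQuotient b K J
  by_cases hyz : y = z
  · rwa [hyz, hz, Set.inter_eq_right.2 hB]
  obtain ⟨s, hs, hs'⟩ := exists_weak_step b
    (by rw [hz]; exact (mem_embeddedQuotient_iff b).1 hy : negSet b y ⊆ negSet b z) hyz
  rw [hz] at hs'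
  have h1 : n < (negSet b (y * simple b s) ∩ B).ncard := by
    by_contra hle
    have h2 := hmax _ ⟨(mem_embeddedQuotient_iff b).2 hs', not_lt.1 hle⟩
    have h3 := length_mul_simple b hs
    omega
  have h2 : negSet b (y * simple b s) ∩ B ⊆ insert (y • (s : ι)) (negSet b y ∩ B) := by
    rw [negSet_mul_simple b hs]
    rintro i ⟨rfl | hi, hiB⟩
    · exact Set.mem_insert _ _
    · exact Set.mem_insert_of_mem _ ⟨hi, hiB⟩
  have h3 := (Set.ncard_le_ncard h2).trans (Set.ncard_insert_le _ _)
  omega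

/-- Both sides are 1 + q + ⋯ + q^ℓ(v): nested traces are determined by their size, and quotient
elements by their length. -/
theorem tracePoly_eq_of_chain {J : Set b.support} {v : P.weylGroup} {B : Set ι}
    (hc : IsInLocalChain b J v) (hmem : v ∈ embeddedQuotient b (letters b v) J)
    (hB : B ⊆ quotientRoots b (letters b v) J) (hcard : B.ncard = length b v) :
    tracePoly b (letters b v) J B = quotientPoly b J v := by
  trans ∑ n ∈ Finset.range (length b v + 1), (X : ℤ[X]) ^ n
  · refine Finset.sum_bij (fun G _ => G.ncard) ?_ ?_ ?_ fun _ _ => rfl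
    · intro G hG
      rw [Set.Finite.mem_toFinset] at hG
      obtain ⟨y, -, rfl⟩ := hG
      rw [Finset.mem_range, Nat.lt_succ_iff, ← hcard]
      exact Set.ncard_le_ncard Set.inter_subset_right
    · intro G hG G' hG' h
      rw [Set.Finite.mem_toFinset] at hG hG'
      obtain ⟨y, hy, rfl⟩ := hG
      obtain ⟨y', hy', rfl⟩ := hG'
      rcases le_total (length b y) (length b y') with hle | hle
      · exact Set.eq_of_subset_of_ncard_le
          (Set.inter_subset_inter_left _ (negSet_subset_of_chain b hc hy hy' hle)) h.ge
      · exact (Set.eq_of_subset_of_ncard_le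
          (Set.inter_subset_inter_left _ (negSet_subset_of_chain b hc hy' hy hle)) h.le).symm
    · intro n hn
      rw [Finset.mem_range, Nat.lt_succ_iff, ← hcard] at hn
      obtain ⟨y, hy, h⟩ := exists_ncard_inter_eq b _ J hB hn
      exact ⟨_, by rw [Set.Finite.mem_toFinset]; exact ⟨y, hy, rfl⟩, h⟩
  · symm
    refine Finset.sum_bij (fun y _ => length b y) ?_ ?_ ?_ fun _ _ => rfl
    · intro y hy
      rw [Set.Finite.mem_toFinset] at hy
      rw [Finset.mem_range, Nat.lt_succ_iff]
      rcases hy.1.eq_or_lt with h | h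
      · rw [h]
      · exact h.le
    · intro y hy y' hy' h
      rw [Set.Finite.mem_toFinset] at hy hy'
      exact eq_of_length_eq_of_chain b hc (below_subset_embeddedQuotient b hy)
        (below_subset_embeddedQuotient b hy') h
    · intro n hn
      rw [Finset.mem_range, Nat.lt_succ_iff] at hn
      obtain ⟨y, -, h1, h2⟩ := exists_length_eq b (x := 1) (z := v) (by simp) (by simp) hn
      refine ⟨y, ?_, h2⟩
      rw [Set.Finite.mem_toFinset]
      exact ⟨bruhatLE_of_negSet_subset b h1, mem_minReps_of_mem_embeddedQuotient b
        ((mem_embeddedQuotient_iff b).2 (h1.trans ((mem_embeddedQuotient_iff b).1 hmem)))⟩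

/-! ### Sign patterns over a pattern on the parabolic part -/

theorem isPos_inv_smul_congr {J : Set b.support} {x y : P.weylGroup}
    (h : ∀ i, Supp b J i → (i ∈ negSet b x ↔ i ∈ negSet b y)) {i : ι} (hi : Supp b J i) :
    b.IsPos (x⁻¹ • i) ↔ b.IsPos (y⁻¹ • i) := by
  by_cases hp : b.IsPos i
  · have := h i hi
    simp only [negSet, mem_ofPred_eq, hp, true_and] at this
    exact not_iff_not.1 this
  · have := h _ hi.opp
    simpa only [negSet, mem_ofPred_eq, isPos_opp, smul_opp, hp, not_false_eq_true, true_and,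
      not_not] using this

theorem signSet_inter {A A' : Set ι} (h : A' ⊆ A) (x : P.weylGroup) :
    signSet b A x ∩ A' = signSet b A' x := by
  ext i
  exact ⟨fun hi => ⟨hi.2, hi.1.2⟩, fun hi => ⟨⟨h hi.1, hi.2⟩, hi.1⟩⟩

theorem isPos_smul_of_mem_negSet {J : Set b.support} {u v : P.weylGroup}
    (hu : u ∈ parabolic b J) (hv : v ∈ minReps b J) {k : ι} (hk : k ∈ negSet b v) :
    b.IsPos (u • k) :=
  isPos_smul_of_not_supp hu hk.1 fun h => hk.2 (isPos_of_mem_minReps b hv hk.1 h)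

/-- This is N(uv) = N(u) ∪ u N(v); the roots in N(v) lie outside Φ_J, so u keeps them positive. -/
theorem mem_negSet_mul_iff {J : Set b.support} {u v : P.weylGroup} (hu : u ∈ parabolic b J)
    (hv : v ∈ minReps b J) {i : ι} :
    i ∈ negSet b (u * v) ↔ i ∈ negSet b u ∨ u⁻¹ • i ∈ negSet b v := by
  constructor
  · rintro ⟨h1, h2⟩
    by_cases h3 : b.IsPos (u⁻¹ • i)
    · exact Or.inr ⟨h3, by rwa [← mul_smul, ← mul_inv_rev]⟩
    · exact Or.inl ⟨h1, h3⟩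
  · rintro (h | h)
    · rw [negSet_eq_of_mul b hu hv] at h
      exact h.1
    · refine ⟨?_, by rw [mul_inv_rev, mul_smul]; exact h.2⟩
      have := isPos_smul_of_mem_negSet b hu hv h
      rwa [smul_inv_smul] at this

theorem quotientRoots_smul {K J : Set b.support} {c : P.weylGroup}
    (hc : c ∈ parabolic b (K ∩ J)) {i : ι} (hi : i ∈ quotientRoots b K J) :
    c • i ∈ quotientRoots b K J :=
  ⟨isPos_smul_of_not_supp hc hi.1 fun h => hi.2.2 (h.mono Set.inter_subset_right),
    (supp_smul (parabolic_mono b Set.inter_subset_left hc)).2 hi.2.1,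
    fun h => hi.2.2 ((supp_smul (parabolic_mono b Set.inter_subset_right hc)).1 h)⟩

/-- The part of a sign pattern on `N(u v)` that is not visible on `N(u)`. -/
theorem signSet_negSet_mul {K J : Set b.support} {u v c y z : P.weylGroup}
    (hu : u ∈ parabolic b J) (hv : v ∈ minReps b J) (hvK : v ∈ embeddedQuotient b K J)
    (hc : c ∈ parabolic b (K ∩ J))
    (hzy : ∀ i, Supp b K i → (i ∈ negSet b z ↔ i ∈ negSet b y)) :
    signSet b (negSet b (u * v)) (u * (c * z)) = signSet b (negSet b u) (u * (c * z)) ∪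
      (fun i => (u * c) • i) '' (negSet b y ∩ {i | c • i ∈ negSet b v}) := by
  have hB : ∀ i, c • i ∈ negSet b v → i ∈ quotientRoots b K J := fun i hi => by
    have := quotientRoots_smul b (inv_mem hc) ((mem_embeddedQuotient_iff b).1 hvK hi)
    rwa [inv_smul_smul] at this
  ext i
  simp only [signSet, mem_ofPred_eq, mem_union, mem_negSet_mul_iff b hu hv, mem_image, mem_inter_iff]
  constructor
  · rintro ⟨h1 | h1, h2⟩
    · exact Or.inl ⟨h1, h2⟩
    · right
      have h3 : c • c⁻¹ • u⁻¹ • i ∈ negSet b v := by rwa [smul_inv_smul]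
      refine ⟨c⁻¹ • u⁻¹ • i, ⟨?_, h3⟩, ?_⟩
      · rw [← hzy _ (hB _ h3).2.1]
        refine ⟨(hB _ h3).1, ?_⟩
        rwa [mul_inv_rev, mul_inv_rev, mul_smul, mul_smul] at h2
      · rw [mul_smul, smul_inv_smul, smul_inv_smul]
  · rintro (⟨h1, h2⟩ | ⟨m, ⟨h1, h2⟩, rfl⟩)
    · exact ⟨Or.inl h1, h2⟩
    · rw [← hzy _ (hB _ h2).2.1] at h1
      refine ⟨Or.inr ?_, ?_⟩
      · rwa [mul_smul, inv_smul_smul]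
      · rw [mul_inv_rev, mul_inv_rev, mul_smul, mul_smul, mul_smul, inv_smul_smul, inv_smul_smul]
        exact h1.2

/-- Over a fixed pattern on N(u), the rest of the pattern is the uc-image of a trace N(y) ∩ B, with
B = c⁻¹N(v). It remains to see that c is constant on the fibre and that y is arbitrary in the
quotient. -/
theorem sum_fiber_eq {K J : Set b.support} {u v : P.weylGroup}
    (hu : u ∈ parabolic b J) (hv : v ∈ minReps b J) (hvK : v ∈ embeddedQuotient b K J)
    (hdesc : ∀ s ∈ K ∩ J, ¬ b.IsPos (u • (s : ι))) (x₀ : P.weylGroup) :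
    ∃ B ⊆ quotientRoots b K J, B.ncard = length b v ∧
      ∑ T ∈ (Set.toFinite {T ∈ Set.range (signSet b (negSet b (u * v))) |
          T ∩ negSet b u = signSet b (negSet b u) x₀}).toFinset, (X : ℤ[X]) ^ T.ncard =
        X ^ (signSet b (negSet b u) x₀).ncard * tracePoly b K J B := by
  obtain ⟨c, hc, z₀, hz₀, hx₀⟩ := exists_parabolic_decomposition b (K ∩ J) (u⁻¹ * x₀)
  obtain rfl : x₀ = u * (c * z₀) := by rw [← hx₀, mul_inv_cancel_left]
  clear hx₀
  have hcJ := parabolic_mono b Set.inter_subset_right hc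
  have hsub : negSet b u ⊆ negSet b (u * v) := fun i hi => (mem_negSet_mul_iff b hu hv).2 (Or.inl hi)
  set B : Set ι := {i | c • i ∈ negSet b v} with hBdef
  have hB : B ⊆ quotientRoots b K J := fun i hi => by
    have := quotientRoots_smul b (inv_mem hc) ((mem_embeddedQuotient_iff b).1 hvK hi)
    rwa [inv_smul_smul] at this
  have hcard : B.ncard = length b v := by
    rw [← ncard_negSet, ← Set.ncard_image_of_injective B (MulAction.injective c)]
    congr 1
    ext i
    refine ⟨?_, fun hi => ⟨c⁻¹ • i, ?_, smul_inv_smul _ _⟩⟩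
    · rintro ⟨m, hm, rfl⟩
      exact hm
    · rw [hBdef, mem_ofPred_eq, smul_inv_smul]
      exact hi
  set T₁ := signSet b (negSet b u) (u * (c * z₀)) with hT₁
  -- the new part never meets the part on `N(u)`
  have hdisj : ∀ m ∈ B, (u * c) • m ∉ T₁ := fun m hm h => h.1.2 (by
    rw [mul_smul, inv_smul_smul]
    exact hm.1)
  have hex : ∀ y ∈ embeddedQuotient b K J, ∃ x,
      signSet b (negSet b (u * v)) x = T₁ ∪ (fun i => (u * c) • i) '' (negSet b y ∩ B) := by
    intro y hy
    obtain ⟨a, ha, r, hr, rfl⟩ := exists_parabolic_decomposition b J z₀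
    have hNa := negSet_eq_of_mul b ha hr
    have hyN := (mem_embeddedQuotient_iff b).1 hy
    -- Replace z₀ by w with the same J-component a, which preserves the pattern on N(u), but with
    -- K-component y. Compatibility holds because a root of N(a) in Φ_K would be a root of Φ_{K∩J}
    -- negated by z₀⁻¹.
    obtain ⟨w, hw1, hw2⟩ := exists_with_components b ha hy.1
      (fun i hi hK => by
        have hJ := supp_of_mem_negSet ha hi
        rw [hNa] at hi
        exact hi.1.2 (isPos_of_mem_minReps b hz₀ hi.1.1 (hK.inter hJ)))
      (fun i hi hJ => (hyN hi).2.2 hJ)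
    refine ⟨u * (c * w), ?_⟩
    rw [signSet_negSet_mul b hu hv hvK hc hw2]
    congr 1
    ext i
    refine and_congr_right fun hi => not_congr ?_
    have hiJ : Supp b J (c⁻¹ • u⁻¹ • i) :=
      (supp_smul (inv_mem hcJ)).2 ((supp_smul (inv_mem hu)).2 (supp_of_mem_negSet hu hi))
    simp only [mul_inv_rev u, mul_inv_rev c, mul_smul _ u⁻¹, mul_smul _ c⁻¹]
    rw [isPos_inv_smul_congr b hw1 hiJ, isPos_mul_inv_smul_iff b ha hr hiJ]
  have hall : ∀ x, signSet b (negSet b u) x = T₁ → ∃ y ∈ embeddedQuotient b K J,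
      signSet b (negSet b (u * v)) x = T₁ ∪ (fun i => (u * c) • i) '' (negSet b y ∩ B) := by
    intro x hx
    obtain ⟨c', hc', z, hz, hxz⟩ := exists_parabolic_decomposition b (K ∩ J) (u⁻¹ * x)
    obtain rfl : x = u * (c' * z) := by rw [← hxz, mul_inv_cancel_left]
    clear hxz
    -- Since u sends each positive root k of Φ_{K∩J} to a negative one, -uk lies in N(u), and its
    -- sign reveals whether k is in N(c).
    have hcc : c' = c := negSet_injective b (by
      rw [negSet_eq_of_mul b hc' hz, negSet_eq_of_mul b hc hz₀]
      ext k
      refine and_congr_left fun hk => and_congr_right fun hkpos => ?_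
      have hm : opp P (u • k) ∈ negSet b u := ⟨by
        rw [isPos_opp]; exact not_isPos_smul_of_supp b hdesc hkpos hk, by
        rw [smul_opp, inv_smul_smul, isPos_opp, not_not]; exact hkpos⟩
      have h1 := Set.ext_iff.1 hx (opp P (u • k))
      simp only [hT₁, signSet, mem_ofPred_eq, hm, true_and, smul_opp, mul_inv_rev u, mul_smul _ u⁻¹,
        inv_smul_smul, isPos_opp, not_not] at h1
      exact not_congr h1)
    subst hcc
    obtain ⟨y, hy, r, hr, rfl⟩ := exists_parabolic_decomposition b K z
    have hNy := negSet_eq_of_mul b hy hr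
    refine ⟨y, (mem_embeddedQuotient_iff b).2 fun i hi => ?_, ?_⟩
    · rw [hNy] at hi
      exact ⟨hi.1.1, hi.2, fun hJ => hi.1.2 (isPos_of_mem_minReps b hz hi.1.1 (hi.2.inter hJ))⟩
    · rw [signSet_negSet_mul b hu hv hvK hc (y := y), hx]
      intro i hi
      rw [hNy]
      exact ⟨fun h => ⟨h, hi⟩, fun h => h.1⟩
  refine ⟨B, hB, hcard, ?_⟩
  rw [tracePoly, Finset.mul_sum]
  symm
  refine Finset.sum_bij (fun G _ => T₁ ∪ (fun i => (u * c) • i) '' G) ?_ ?_ ?_ ?_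
  · intro G hG
    rw [Set.Finite.mem_toFinset] at hG ⊢
    obtain ⟨y, hy, rfl⟩ := hG
    obtain ⟨x, hx⟩ := hex y hy
    refine ⟨⟨x, hx⟩, ?_⟩
    rw [Set.union_inter_distrib_right, Set.inter_eq_left.2 (fun i hi => hi.1 : T₁ ⊆ negSet b u)]
    refine Set.union_eq_left.2 ?_
    rintro _ ⟨⟨m, hm, rfl⟩, h⟩
    refine absurd hm.2.1 ?_
    have := h.2
    simpa only [mul_smul, inv_smul_smul] using this
  · have key : ∀ G G' : Set ι, G ⊆ B → T₁ ∪ (fun i => (u * c) • i) '' G =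
        T₁ ∪ (fun i => (u * c) • i) '' G' → G ⊆ G' := by
      intro G G' hG h m hm
      have h1 : (u * c) • m ∈ T₁ ∪ (fun i => (u * c) • i) '' G' := by
        rw [← h]; exact Or.inr ⟨m, hm, rfl⟩
      obtain ⟨m', hm', h2⟩ := h1.resolve_left (hdisj m (hG hm))
      rwa [← MulAction.injective (u * c) h2]
    intro G hG G' hG' h
    rw [Set.Finite.mem_toFinset] at hG hG'
    obtain ⟨y, hy, rfl⟩ := hG
    obtain ⟨y', hy', rfl⟩ := hG'
    exact (key _ _ Set.inter_subset_right h).antisymm (key _ _ Set.inter_subset_right h.symm)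
  · intro T hT
    rw [Set.Finite.mem_toFinset] at hT
    obtain ⟨⟨x, rfl⟩, hx⟩ := hT
    rw [signSet_inter b hsub] at hx
    obtain ⟨y, hy, h⟩ := hall x hx
    exact ⟨_, by rw [Set.Finite.mem_toFinset]; exact ⟨y, hy, rfl⟩, h.symm⟩
  · intro G hG
    rw [Set.Finite.mem_toFinset] at hG
    obtain ⟨y, hy, rfl⟩ := hG
    rw [Set.ncard_union_eq, Set.ncard_image_of_injective _ (MulAction.injective (u * c)), pow_add]
    rw [Set.disjoint_left]
    rintro _ h ⟨m, hm, rfl⟩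
    exact hdisj m hm.2 h

/-- Once the trace polynomial is the same for every admissible B, it factors out of the sum over
fibres. -/
theorem signPoly_negSet_mul {K J : Set b.support} {u v : P.weylGroup}
    (hu : u ∈ parabolic b J) (hv : v ∈ minReps b J) (hvK : v ∈ embeddedQuotient b K J)
    (hdesc : ∀ s ∈ K ∩ J, ¬ b.IsPos (u • (s : ι))) {Q : ℤ[X]}
    (hQ : ∀ B ⊆ quotientRoots b K J, B.ncard = length b v → tracePoly b K J B = Q) :
    signPoly b (negSet b (u * v)) = signPoly b (negSet b u) * Q := by
  classical
  have hsub : negSet b u ⊆ negSet b (u * v) := fun i hi => (mem_negSet_mul_iff b hu hv).2 (Or.inl hi)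
  rw [signPoly, signPoly, Finset.sum_mul,
    ← Finset.sum_fiberwise_of_maps_to
      (t := (Set.toFinite (Set.range (signSet b (negSet b u)))).toFinset)
      (g := fun T => T ∩ negSet b u)]
  · refine Finset.sum_congr rfl fun T₁ hT₁ => ?_
    rw [Set.Finite.mem_toFinset] at hT₁
    obtain ⟨x₀, rfl⟩ := hT₁
    obtain ⟨B, hB, hcard, h⟩ := sum_fiber_eq b hu hv hvK hdesc x₀
    rw [hQ B hB hcard] at h
    rw [← h]
    refine Finset.sum_congr ?_ fun _ _ => rfl
    ext T
    simp
  · intro T hT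
    rw [Set.Finite.mem_toFinset] at hT ⊢
    obtain ⟨x, rfl⟩ := hT
    rw [signSet_inter b hsub]
    exact ⟨x, rfl⟩

theorem poincarePoly_eq_distancePoly_of_decomposition {J : Set b.support} {w u v : P.weylGroup}
    (h : IsMaxParabolicDecomposition b J w u v)
    (hv : IsLocallyLongest b J v ∨ IsInLocalChain b J v)
    (hu : poincarePoly b u = distancePoly b u) :
    poincarePoly b w = distancePoly b w := by
  obtain ⟨hw, huJ, hvJ, -⟩ := id h
  have hmem : v ∈ embeddedQuotient b (letters b v) J :=
    mem_embeddedQuotient_of_mem_minReps b (mem_parabolic_letters b v) hvJ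
  -- Inverting both elements replaces the inversion sets by N(u) and N(w), to which w = uv applies
  -- directly.
  rw [poincarePoly_eq_mul b h, hu, ← distancePoly_inv b u, ← distancePoly_inv b w,
    distancePoly_eq_signPoly, distancePoly_eq_signPoly, inversionSet_eq, inversionSet_eq, inv_inv,
    inv_inv, hw]
  refine (signPoly_negSet_mul b huJ hvJ hmem
    (fun s hs => not_isPos_of_mem_letters b h hs.1 hs.2) fun B hB hcard => ?_).symm
  rcases hv with hv | hv
  · exact tracePoly_eq_of_locallyLongest b hv.2.1 hmem hB hcard
  · exact tracePoly_eq_of_chain b hv hmem hB hcard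

end WeylBruhat

end

theorem mainTheorem9 {ι M N : Type*} [Finite ι] [AddCommGroup M] [Module ℝ M]
    [AddCommGroup N] [Module ℝ N] (P : RootPairing ι ℝ M N) [P.IsRootSystem]
    [P.IsCrystallographic] [P.IsReduced] (b : P.Base) (s : b.support) (w u v : P.weylGroup)
    (hBP : WeylBruhat.IsBPDecomposition b s w u v)
    (hv : WeylBruhat.IsLocallyLongest b {s}ᶜ v ∨ WeylBruhat.IsInLocalChain b {s}ᶜ v)
    (hu : WeylBruhat.poincarePoly b u = WeylBruhat.distancePoly b u) :
    WeylBruhat.poincarePoly b w = WeylBruhat.distancePoly b w := by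
  rcases hBP.2 with h | h
  · exact WeylBruhat.poincarePoly_eq_distancePoly_of_decomposition b h hv hu
  · rw [← WeylBruhat.poincarePoly_inv, ← WeylBruhat.distancePoly_inv]
    exact WeylBruhat.poincarePoly_eq_distancePoly_of_decomposition b h hv hu
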